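/- Let $n\ge 1$ be an integer and let $\mathbb{S}^n=\{x\in\mathbb{R}^{n+1} : |x|=1\}$ carry the round metric, i.e. the Riemannian metric induced by the Euclidean metric of $\mathbb{R}^{n+1}$. Let $N(x)$ be the number of eigenvalues $\le x$, counted with multiplicity, of the Laplace operator $-\operatorname{div}\operatorname{grad}$ acting on smooth functions on $\mathbb{S}^n$, where the multiplicity of an eigenvalue is the dimension of its eigenspace. Let $$w(x)=\frac{\omega_n}{(2\pi)^n}\,|\mathbb{S}^n|\,x^{n/2}$$ be the Weyl function of $\mathbb{S}^n$, where $\omega_n$ is the volume of the unit ball of $\mathbb{R}^n$ and $|\mathbb{S}^n|$ is the volume of $\mathbb{S}^n$. For each integer $k\ge 0$ put $v_k=k(k+n-1)$. Then for every integer $k\ge 0$ the number $N(v_k)$ is finite and $$w(v_k)<N(v_k),$$ and for every integer $k\ge 0$ with $k>\frac{n^2}{4}-n$, $$N(v_k)<w(v_{k+1}).$$ -/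

import Mathlib

open scoped Manifold ContDiff

noncomputable section

namespace RoundSphere

/-- The ambient Euclidean space `ℝ^{n+1}`. -/
abbrev Amb (n : ℕ) : Type := EuclideanSpace ℝ (Fin (n + 1))

/-- The round sphere `𝕊^n = {x ∈ ℝ^{n+1} | |x| = 1}`. -/
abbrev Sph (n : ℕ) : Type := Metric.sphere (0 : Amb n) 1

/-- The tangent space of `𝕊^n` at `x`, i.e. `x^⊥ ⊆ ℝ^{n+1}`. The inner product it inherits from
`ℝ^{n+1}` is the round metric. -/
abbrev Tan {n : ℕ} (x : Sph n) : Submodule ℝ (Amb n) := (Submodule.span ℝ {(x : Amb n)})ᗮ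

/-- A point of the sphere, used only as the value of `radial` at the origin. -/
def basePoint (n : ℕ) : Sph n := ⟨EuclideanSpace.single 0 1, by simp⟩

/-- The radial retraction `y ↦ y / |y|` of `ℝ^{n+1} ∖ {0}` onto `𝕊^n`. -/
def radial {n : ℕ} (y : Amb n) : Sph n :=
  if h : y = 0 then basePoint n
  else ⟨‖y‖⁻¹ • y, by simp [norm_smul, h]⟩

/-- The differential `d f_x : T_x 𝕊^n → F` of a map on the sphere: the restriction to `T_x 𝕊^n` of
the derivative at `x` of the extension `y ↦ f (y / |y|)` of `f` to `ℝ^{n+1} ∖ {0}`. -/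
def dSph {n : ℕ} {F : Type*} [NormedAddCommGroup F] [NormedSpace ℝ F]
    (f : Sph n → F) (x : Sph n) : Tan x →L[ℝ] F :=
  (fderiv ℝ (fun y => f (radial y)) (x : Amb n)).comp (Tan x).subtypeL

/-- The Riemannian gradient: `⟪grad f (x), v⟫ = d f_x (v)` for every `v ∈ T_x 𝕊^n`. -/
def grad {n : ℕ} (f : Sph n → ℝ) (x : Sph n) : Tan x :=
  (InnerProductSpace.toDual ℝ (Tan x)).symm (dSph f x)

/-- The Levi-Civita covariant derivative `v ↦ ∇_v X` at `x` of a vector field `X` tangent to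
`𝕊^n ⊆ ℝ^{n+1}`: the tangential component of the derivative of `X` as an `ℝ^{n+1}`-valued map. -/
def covDeriv {n : ℕ} (X : (x : Sph n) → Tan x) (x : Sph n) : Tan x →L[ℝ] Tan x :=
  (Tan x).orthogonalProjectionOnto.comp (dSph (fun z => (X z : Amb n)) x)

/-- The Riemannian divergence: the trace of `v ↦ ∇_v X`. -/
def divg {n : ℕ} (X : (x : Sph n) → Tan x) (x : Sph n) : ℝ :=
  LinearMap.trace ℝ (Tan x) (covDeriv X x : Tan x →ₗ[ℝ] Tan x)

/-- The Laplace operator `-div grad` of the round sphere. -/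
def laplace {n : ℕ} (f : Sph n → ℝ) (x : Sph n) : ℝ := -divg (grad f) x

theorem contDiffAt_comp_radial {n : ℕ} {f : Sph n → ℝ} (hf : ContMDiff (𝓡 n) 𝓘(ℝ) ∞ f)
    {x : Amb n} (hx : x ≠ 0) : ContDiffAt ℝ ∞ (fun y => f (radial y)) x := by
  have := Fact.mk (@finrank_euclideanSpace_fin ℝ _ (n + 1))
  let U : TopologicalSpace.Opens (Amb n) := ⟨{0}ᶜ, isOpen_compl_singleton⟩
  have h1 : ContMDiff 𝓘(ℝ, Amb n) 𝓘(ℝ, Amb n) ∞ (fun y : U => ‖(y : Amb n)‖⁻¹ • (y : Amb n)) := by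
    intro y
    have hy : (y : Amb n) ≠ 0 := y.2
    have : ContDiffAt ℝ ∞ (fun y : Amb n => ‖y‖⁻¹ • y) (y : Amb n) :=
      ((contDiffAt_norm ℝ hy).inv (norm_ne_zero_iff.2 hy)).smul contDiffAt_id
    exact (contMDiffAt_subtype_iff (f := fun y : Amb n => ‖y‖⁻¹ • y)).2 this.contMDiffAt
  have h2 : ∀ y : U, ‖(y : Amb n)‖⁻¹ • (y : Amb n) ∈ Metric.sphere (0 : Amb n) 1 := by
    intro y
    have hy : (y : Amb n) ≠ 0 := y.2
    simp [norm_smul, hy]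
  have h3 := hf.comp (h1.codRestrict_sphere h2)
  have h4 : ContMDiff 𝓘(ℝ, Amb n) 𝓘(ℝ) ∞ (fun y : U => f (radial (y : Amb n))) := by
    convert! h3 using 1
    funext y
    have hy : (y : Amb n) ≠ 0 := y.2
    simp [radial, hy, Set.codRestrict]
  exact ((contMDiffAt_subtype_iff (f := fun y : Amb n => f (radial y)) (x := ⟨x, hx⟩)).1
    (h4 ⟨x, hx⟩)).contDiffAt

theorem coe_ne_zero {n : ℕ} (x : Sph n) : (x : Amb n) ≠ 0 :=
  ne_zero_of_mem_unit_sphere x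

theorem coe_radial {n : ℕ} {y : Amb n} (hy : y ≠ 0) : (radial y : Amb n) = ‖y‖⁻¹ • y := by
  simp [radial, hy]

theorem radial_smul {n : ℕ} {y : Amb n} {t : ℝ} (ht : 0 < t) : radial (t • y) = radial y := by
  by_cases hy : y = 0
  · simp [hy]
  · apply Subtype.ext
    rw [coe_radial (smul_ne_zero ht.ne' hy), coe_radial hy, norm_smul, smul_smul,
      Real.norm_of_nonneg ht.le, mul_inv, mul_right_comm, inv_mul_cancel₀ ht.ne', one_mul]

theorem fderiv_comp_radial_self {n : ℕ} {f : Sph n → ℝ} (hf : ContMDiff (𝓡 n) 𝓘(ℝ) ∞ f)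
    (x : Sph n) : fderiv ℝ (fun y => f (radial y)) (x : Amb n) (x : Amb n) = 0 := by
  have h := ((contDiffAt_comp_radial hf (coe_ne_zero x)).differentiableAt (by simp)).hasFDerivAt
  have h1 : HasDerivAt (fun t : ℝ => t • (x : Amb n)) (x : Amb n) 1 := by
    simpa using (hasDerivAt_id (1 : ℝ)).smul_const (x : Amb n)
  have h2 := HasFDerivAt.comp_hasDerivAt (1 : ℝ) (by simpa using h) h1
  have h3 : (fun t : ℝ => f (radial (t • (x : Amb n)))) =ᶠ[nhds 1]
      fun _ => f (radial (x : Amb n)) := by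
    filter_upwards [lt_mem_nhds one_pos] with t ht
    rw [radial_smul ht]
  exact h2.unique ((hasDerivAt_const (1 : ℝ) _).congr_of_eventuallyEq h3)

theorem coe_grad {n : ℕ} {f : Sph n → ℝ} (hf : ContMDiff (𝓡 n) 𝓘(ℝ) ∞ f) (x : Sph n) :
    (grad f x : Amb n) =
      (InnerProductSpace.toDual ℝ (Amb n)).symm (fderiv ℝ (fun y => f (radial y)) (x : Amb n)) := by
  refine ext_inner_right ℝ fun u => ?_
  rw [InnerProductSpace.toDual_symm_apply]
  obtain ⟨a, ha, b, hb, rfl⟩ :=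
    (Submodule.span ℝ {(x : Amb n)}).exists_add_mem_mem_orthogonal u
  obtain ⟨c, rfl⟩ := Submodule.mem_span_singleton.1 ha
  have h1 : inner ℝ (grad f x : Amb n) (c • (x : Amb n)) = 0 :=
    Submodule.inner_left_of_mem_orthogonal ha (grad f x).2
  have h2 : inner ℝ (grad f x : Amb n) b = fderiv ℝ (fun y => f (radial y)) (x : Amb n) b :=
    InnerProductSpace.toDual_symm_apply (𝕜 := ℝ) (x := (⟨b, hb⟩ : Tan x)) (y := dSph f x)
  rw [inner_add_right, h1, h2, map_add, map_smul, fderiv_comp_radial_self hf]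
  simp

theorem differentiableAt_grad {n : ℕ} {f : Sph n → ℝ} (hf : ContMDiff (𝓡 n) 𝓘(ℝ) ∞ f)
    (x : Sph n) :
    DifferentiableAt ℝ (fun y => (grad f (radial y) : Amb n)) (x : Amb n) := by
  simp only [coe_grad hf]
  have hx := coe_ne_zero x
  have h1 : DifferentiableAt ℝ (fun y : Amb n => (radial y : Amb n)) (x : Amb n) := by
    have : DifferentiableAt ℝ (fun y : Amb n => ‖y‖⁻¹ • y) (x : Amb n) :=
      ((((contDiffAt_norm ℝ hx).inv (norm_ne_zero_iff.2 hx)).smul contDiffAt_id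
        : ContDiffAt ℝ ∞ (fun y : Amb n => ‖y‖⁻¹ • y) (x : Amb n))).differentiableAt (by simp)
    refine this.congr_of_eventuallyEq ?_
    filter_upwards [isOpen_compl_singleton.mem_nhds hx] with y hy
    exact coe_radial hy
  have h2 : DifferentiableAt ℝ (fderiv ℝ (fun y => f (radial y))) (radial (x : Amb n) : Amb n) :=
    ((contDiffAt_comp_radial hf (coe_ne_zero _)).fderiv_right (m := 1)
      (by norm_cast)).differentiableAt (by simp)
  have h3 := DifferentiableAt.comp (x : Amb n) h2 h1
  exact (InnerProductSpace.toDual ℝ (Amb n)).symm.toContinuousLinearEquiv.differentiableAt.comp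
    (x : Amb n) h3

theorem laplace_add {n : ℕ} {f g : Sph n → ℝ} (hf : ContMDiff (𝓡 n) 𝓘(ℝ) ∞ f)
    (hg : ContMDiff (𝓡 n) 𝓘(ℝ) ∞ g) (x : Sph n) :
    laplace (f + g) x = laplace f x + laplace g x := by
  have h1 : ∀ z, grad (f + g) z = grad f z + grad g z := by
    intro z
    have hf' := (contDiffAt_comp_radial hf (coe_ne_zero z)).differentiableAt (by simp)
    have hg' := (contDiffAt_comp_radial hg (coe_ne_zero z)).differentiableAt (by simp)
    simp only [grad, ← map_add]
    congr 1
    ext v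
    simp [dSph, fderiv_fun_add hf' hg']
  have h2 : covDeriv (grad (f + g)) x = covDeriv (grad f) x + covDeriv (grad g) x := by
    ext v
    simp [covDeriv, dSph, h1, fderiv_fun_add (differentiableAt_grad hf x)
      (differentiableAt_grad hg x)]
  simp [laplace, divg, h2]
  ring

theorem laplace_smul {n : ℕ} {f : Sph n → ℝ} (hf : ContMDiff (𝓡 n) 𝓘(ℝ) ∞ f) (c : ℝ)
    (x : Sph n) : laplace (c • f) x = c * laplace f x := by
  have h1 : ∀ z, grad (c • f) z = c • grad f z := by
    intro z
    have hf' := (contDiffAt_comp_radial hf (coe_ne_zero z)).differentiableAt (by simp)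
    have h : dSph (c • f) z = c • dSph f z := by
      ext v
      simp [dSph, fderiv_const_mul hf']
    simp [grad, h]
  have h2 : covDeriv (grad (c • f)) x = c • covDeriv (grad f) x := by
    ext v
    simp [covDeriv, dSph, h1, fderiv_fun_const_smul (differentiableAt_grad hf x)]
  simp [laplace, divg, h2]

/-- The eigenspace of `-div grad` on `C^∞(𝕊^n)` for the real number `μ`. -/
def eigenspace (n : ℕ) (μ : ℝ) : Submodule ℝ (Sph n → ℝ) where
  carrier := {f | ContMDiff (𝓡 n) 𝓘(ℝ) ∞ f ∧ ∀ x, laplace f x = μ * f x}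
  add_mem' := by
    rintro f g ⟨hf, hf'⟩ ⟨hg, hg'⟩
    refine ⟨hf.add hg, fun x => ?_⟩
    rw [laplace_add hf hg, hf', hg', Pi.add_apply, mul_add]
  zero_mem' := by
    refine ⟨contMDiff_const, fun x => ?_⟩
    have := laplace_smul (n := n) (f := fun _ => 0) contMDiff_const 0 x
    rw [zero_smul, zero_mul] at this
    rw [this]
    simp
  smul_mem' := by
    rintro c f ⟨hf, hf'⟩
    refine ⟨(contMDiff_const (c := c)).mul hf, fun x => ?_⟩
    rw [laplace_smul hf, hf', Pi.smul_apply, smul_eq_mul]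
    ring

/-- The multiplicity of `μ` as an eigenvalue of `𝕊^n` (`0` if `μ` is not an eigenvalue). -/
def mult (n : ℕ) (μ : ℝ) : ℕ∞ := Cardinal.toENat (Module.rank ℝ (eigenspace n μ))

/-- The eigenvalue counting function `N(x)` of `𝕊^n`: the number of eigenvalues `≤ x`, counted with
multiplicity. -/
def counting (n : ℕ) (x : ℝ) : ℕ∞ := ∑' μ : Set.Iic x, mult n μ

/-- The volume `ω_n` of the unit ball of `ℝ^n`. -/
def ballVolume (n : ℕ) : ℝ :=
  (MeasureTheory.volume (Metric.ball (0 : EuclideanSpace ℝ (Fin n)) 1)).toReal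

/-- The volume `|𝕊^n|`, for the surface measure that Lebesgue measure induces on the unit sphere. -/
def sphereVolume (n : ℕ) : ℝ :=
  ((MeasureTheory.volume : MeasureTheory.Measure (Amb n)).toSphere Set.univ).toReal

/-- The Weyl function `w(x) = ω_n (2π)^{-n} |𝕊^n| x^{n/2}` of `𝕊^n`. -/
def weyl (n : ℕ) (x : ℝ) : ℝ :=
  ballVolume n / (2 * Real.pi) ^ n * sphereVolume n * x ^ ((n : ℝ) / 2)

/-- `v_k = k (k + n - 1)`. -/
def v (n k : ℕ) : ℝ := (k : ℝ) * ((k : ℝ) + (n : ℝ) - 1)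

end RoundSphere

end

noncomputable section

namespace RoundSphere

/-! The spectrum is computed from the filtration of functions on the sphere by polynomial degree,
where `polyLT n k` consists of the restrictions of polynomials of degree `< k`. By the product rule
`laplace_mul`, the Laplacian acts on degree `m` as multiplication by `v n m` modulo lower degree
(`laplace_sub_smul_mem_polyLT`). Since `v n` is strictly increasing, `laplace - v n k` maps `polyLT
n (k + 1)` onto `polyLT n k` with kernel the eigenspace of `v n k` (`finrank_polyLT_succ`).

There are no other eigenfunctions: the Laplacian is symmetric (`integral_mul_laplace_comm`) and
polynomials are dense by Stone–Weierstrass, so every smooth eigenfunction is a polynomial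
(`mem_polyLT_of_mem_eigenspace`). Hence `N(v_k)` is the dimension of `polyLT n (k + 1)`.

The relation `x₀² = 1 - ∑ xᵢ²` writes each such function uniquely as `a + x₀ b` with `a`, `b`
polynomials in the other coordinates, of degrees `≤ k` and `< k`. Therefore `N(v_k) = C(n+k, n) +
C(n+k-1, n) = (2/n!) (k + n/2) (k+1)⋯(k+n-1)`, while the duplication formula for `Γ` gives `w(x) =
(2/n!) x^{n/2}`. Squaring and pairing `k + j` with `k + n - j` reduces both inequalities to
comparing `v_k` or `v_{k+1}` with `k² + kn + j(n-j)` and with `(k + n/2)²`. As `j(n-j) ≤ n²/4`, the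
upper bound needs exactly `n²/4 < k + n`. -/

variable {n : ℕ}

/-! ### The Laplacian through degree-`0` homogeneous extensions -/

/-- The extension of a function on the sphere to `ℝ^{n+1} ∖ {0}`, homogeneous of degree `0`. -/
def homExt (f : Sph n → ℝ) : Amb n → ℝ := fun y => f (radial y)

/-- The `i`-th partial derivative. -/
def pd (i : Fin (n + 1)) (F : Amb n → ℝ) : Amb n → ℝ :=
  fun y => fderiv ℝ F y (EuclideanSpace.single i 1)

/-- The smooth functions on the sphere. -/
def smoothFun (n : ℕ) : Subalgebra ℝ (Sph n → ℝ) where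
  carrier := {f | ContMDiff (𝓡 n) 𝓘(ℝ) ∞ f}
  mul_mem' := fun hf hg => ContMDiff.mul hf hg
  add_mem' := fun hf hg => ContMDiff.add hf hg
  algebraMap_mem' := fun _ => contMDiff_const

theorem contDiffAt_homExt {f : Sph n → ℝ} (hf : f ∈ smoothFun n) {y : Amb n} (hy : y ≠ 0) :
    ContDiffAt ℝ ∞ (homExt f) y :=
  contDiffAt_comp_radial hf hy

theorem differentiableAt_homExt {f : Sph n → ℝ} (hf : f ∈ smoothFun n) {y : Amb n} (hy : y ≠ 0) :
    DifferentiableAt ℝ (homExt f) y :=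
  (contDiffAt_homExt hf hy).differentiableAt (by simp)

theorem contDiffAt_pd (i : Fin (n + 1)) {F : Amb n → ℝ} {y : Amb n} (hF : ContDiffAt ℝ ∞ F y) :
    ContDiffAt ℝ ∞ (pd i F) y :=
  (hF.fderiv_right (m := ∞) (by norm_cast)).clm_apply contDiffAt_const

theorem radial_coe (x : Sph n) : radial (x : Amb n) = x := by
  apply Subtype.ext
  simp [coe_radial (coe_ne_zero x)]

theorem homExt_coe (f : Sph n → ℝ) (x : Sph n) : homExt f (x : Amb n) = f x := by
  simp [homExt, radial_coe]

theorem eventually_ne_zero {y : Amb n} (hy : y ≠ 0) : ∀ᶠ z in nhds y, z ≠ 0 :=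
  isOpen_compl_singleton.mem_nhds hy

/-- Euler's relation in degree `0`: the extension is constant along rays. -/
theorem fderiv_homExt_self {f : Sph n → ℝ} (hf : f ∈ smoothFun n) {y : Amb n} (hy : y ≠ 0) :
    fderiv ℝ (homExt f) y y = 0 := by
  have h := (differentiableAt_homExt hf hy).hasFDerivAt
  have h1 : HasDerivAt (fun t : ℝ => t • y) y 1 := by
    simpa using (hasDerivAt_id (1 : ℝ)).smul_const y
  have h2 := HasFDerivAt.comp_hasDerivAt (1 : ℝ) (by simpa using h) h1
  have h3 : (fun t : ℝ => homExt f (t • y)) =ᶠ[nhds 1] fun _ => homExt f y := by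
    filter_upwards [lt_mem_nhds one_pos] with t ht
    simp only [homExt]
    rw [radial_smul ht]
  exact h2.unique ((hasDerivAt_const (1 : ℝ) _).congr_of_eventuallyEq h3)

theorem hasFDerivAt_radial (x : Sph n) :
    HasFDerivAt (fun y : Amb n => (radial y : Amb n))
      (ContinuousLinearMap.id ℝ (Amb n) -
        (innerSL ℝ (x : Amb n)).smulRight (x : Amb n)) (x : Amb n) := by
  have hx : ‖(x : Amb n)‖ = 1 := norm_eq_of_mem_sphere x
  have h1 : HasFDerivAt (fun y : Amb n => ‖y‖ ^ 2) (2 • innerSL ℝ (x : Amb n)) (x : Amb n) :=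
    (hasStrictFDerivAt_norm_sq (x : Amb n)).hasFDerivAt
  have h2 := (h1.sqrt (by simp [hx]))
  have h3 := (hasDerivAt_inv (x := √(‖(x : Amb n)‖ ^ 2)) (by simp [hx])).comp_hasFDerivAt
    (x : Amb n) h2
  have h4 := h3.smul (hasFDerivAt_id (𝕜 := ℝ) (x : Amb n))
  refine HasFDerivAt.congr_of_eventuallyEq (f₁ := fun y : Amb n => (radial y : Amb n))
    (h4.congr_fderiv ?_) ?_
  · ext v
    simp [hx]
    ring
  · filter_upwards [eventually_ne_zero (coe_ne_zero x)] with y hy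
    simp [coe_radial hy]

/-- Differentiating Euler's relation `DF(y) y = 0` along `x` gives `D²F(x)(x, x) + DF(x) x = 0`, and
the second term vanishes. -/
theorem fderiv_fderiv_homExt_self {f : Sph n → ℝ} (hf : f ∈ smoothFun n) (x : Sph n) :
    fderiv ℝ (fderiv ℝ (homExt f)) (x : Amb n) (x : Amb n) (x : Amb n) = 0 := by
  have hx := coe_ne_zero x
  have h1 : HasFDerivAt (fderiv ℝ (homExt f)) (fderiv ℝ (fderiv ℝ (homExt f)) (x : Amb n))
      (x : Amb n) :=
    (((contDiffAt_homExt hf hx).fderiv_right (m := 1)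
      (by norm_cast)).differentiableAt (by simp)).hasFDerivAt
  have h2 := h1.clm_apply (hasFDerivAt_id (𝕜 := ℝ) (x : Amb n))
  have h3 : (fun y => fderiv ℝ (homExt f) y (id y)) =ᶠ[nhds (x : Amb n)] fun _ => 0 := by
    filter_upwards [eventually_ne_zero hx] with y hy
    exact fderiv_homExt_self hf hy
  have h4 := h2.unique ((hasFDerivAt_const (0 : ℝ) _).congr_of_eventuallyEq h3)
  have h5 := DFunLike.congr_fun h4 (x : Amb n)
  simpa [fderiv_homExt_self hf hx] using h5

theorem pd_pd (i : Fin (n + 1)) {F : Amb n → ℝ} {y : Amb n} (hF : ContDiffAt ℝ ∞ F y) :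
    pd i (pd i F) y = fderiv ℝ (fderiv ℝ F) y (EuclideanSpace.single i 1)
      (EuclideanSpace.single i 1) := by
  have h1 : DifferentiableAt ℝ (fderiv ℝ F) y :=
    (hF.fderiv_right (m := 1) (by norm_cast)).differentiableAt (by simp)
  unfold pd
  rw [fderiv_clm_apply h1 (differentiableAt_const _)]
  simp

theorem coe_proj_tan (x : Sph n) (w : Amb n) :
    ((Tan x).orthogonalProjectionOnto w : Amb n) = w - inner ℝ (x : Amb n) w • (x : Amb n) := by
  have hx : ‖(x : Amb n)‖ = 1 := norm_eq_of_mem_sphere x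
  have := Submodule.starProjection_orthogonal_val (K := Submodule.span ℝ {(x : Amb n)}) w
  rw [Submodule.starProjection_apply, Submodule.starProjection_singleton] at this
  simpa [hx] using this

/-- The divergence is a trace over the tangent space only. It equals the full Euclidean trace of the
Hessian of the extension minus its radial entry `D²F(x)(x, x)`, which is zero. -/
theorem laplace_eq {f : Sph n → ℝ} (hf : f ∈ smoothFun n) (x : Sph n) :
    laplace f x = -∑ i, pd i (pd i (homExt f)) (x : Amb n) := by
  have hx := coe_ne_zero x
  have h1 : HasFDerivAt (fderiv ℝ (homExt f)) (fderiv ℝ (fderiv ℝ (homExt f)) (x : Amb n))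
      (radial (x : Amb n) : Amb n) := by
    rw [radial_coe]
    exact (((contDiffAt_homExt hf hx).fderiv_right (m := 1)
      (by norm_cast)).differentiableAt (by simp)).hasFDerivAt
  set D := fderiv ℝ (fderiv ℝ (homExt f)) (x : Amb n) with hD
  let e := (InnerProductSpace.toDual ℝ (Amb n)).symm.toContinuousLinearEquiv
  have h2 := (e.hasFDerivAt.comp (x : Amb n)
    (h1.comp (x : Amb n) (hasFDerivAt_radial x))).congr_of_eventuallyEq
      (f₁ := fun y => (grad f (radial y) : Amb n))
      (Filter.Eventually.of_forall fun y => coe_grad hf _)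
  let T : Amb n →ₗ[ℝ] Amb n := e.toLinearMap ∘ₗ D.toLinearMap
  have h3 : (covDeriv (grad f) x : Tan x →ₗ[ℝ] Tan x) =
      ((Tan x).orthogonalProjectionOnto : Amb n →ₗ[ℝ] Tan x) ∘ₗ (T ∘ₗ (Tan x).subtype) := by
    ext v
    have hv : inner ℝ (x : Amb n) (v : Amb n) = 0 :=
      Submodule.mem_orthogonal_singleton_iff_inner_right.1 v.2
    simp [covDeriv, dSph, h2.fderiv, hv, T, e]
  -- Cyclicity of the trace moves the computation to `ℝ^{n+1}`, where the standard basis is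
  -- available.
  rw [laplace, divg, h3, LinearMap.trace_comp_comm',
    LinearMap.trace_eq_sum_inner _ (EuclideanSpace.basisFun (Fin (n + 1)) ℝ)]
  have h4 : ∀ i, inner ℝ (EuclideanSpace.basisFun (Fin (n + 1)) ℝ i)
      (((T ∘ₗ (Tan x).subtype) ∘ₗ ((Tan x).orthogonalProjectionOnto : Amb n →ₗ[ℝ] Tan x))
        (EuclideanSpace.basisFun (Fin (n + 1)) ℝ i)) =
      pd i (pd i (homExt f)) (x : Amb n) -
        D (x : Amb n) ((x : Amb n) i • EuclideanSpace.single i 1) := by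
    intro i
    rw [pd_pd i (contDiffAt_homExt hf hx), ← hD, real_inner_comm]
    simp only [LinearMap.comp_apply, ContinuousLinearMap.coe_coe, Submodule.subtype_apply,
      coe_proj_tan, T, e]
    have (l : Amb n →L[ℝ] ℝ) : ((InnerProductSpace.toDual ℝ (Amb n)).symm l) i =
        l (EuclideanSpace.single i 1) := by
      have h := InnerProductSpace.toDual_symm_apply (x := EuclideanSpace.single i 1) (y := l)
      rw [EuclideanSpace.inner_single_right] at h
      simpa using h
    simp [EuclideanSpace.basisFun_apply, this, EuclideanSpace.inner_single_right]
  rw [Finset.sum_congr rfl fun i _ => h4 i, Finset.sum_sub_distrib, ← map_sum]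
  have h5 : ∑ i, (x : Amb n) i • EuclideanSpace.single i (1 : ℝ) = (x : Amb n) := by
    have := (EuclideanSpace.basisFun (Fin (n + 1)) ℝ).sum_repr (x : Amb n)
    simpa using this
  rw [h5, hD, fderiv_fderiv_homExt_self hf x, sub_zero]

/-! ### Product rules and coordinate functions -/

theorem pd_mul (i : Fin (n + 1)) {F G : Amb n → ℝ} {y : Amb n} (hF : DifferentiableAt ℝ F y)
    (hG : DifferentiableAt ℝ G y) : pd i (F * G) y = F y * pd i G y + G y * pd i F y := by
  simp [pd, fderiv_mul hF hG]

theorem homExt_mul (f g : Sph n → ℝ) : homExt (f * g) = homExt f * homExt g := rfl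

/-- The pointwise inner product of the gradients of two functions on the sphere. -/
def gradInner (f g : Sph n → ℝ) (x : Sph n) : ℝ :=
  ∑ i, pd i (homExt f) (x : Amb n) * pd i (homExt g) (x : Amb n)

theorem gradInner_mul {f g h : Sph n → ℝ} (hg : g ∈ smoothFun n)
    (hh : h ∈ smoothFun n) :
    gradInner f (g * h) = g * gradInner f h + h * gradInner f g := by
  ext x
  have hx := coe_ne_zero x
  simp only [gradInner, homExt_mul, Pi.add_apply, Pi.mul_apply, Finset.mul_sum,
    ← Finset.sum_add_distrib]
  refine Finset.sum_congr rfl fun i _ => ?_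
  rw [pd_mul i (differentiableAt_homExt hg hx) (differentiableAt_homExt hh hx), homExt_coe,
    homExt_coe]
  ring

theorem laplace_mul {f g : Sph n → ℝ} (hf : f ∈ smoothFun n) (hg : g ∈ smoothFun n) :
    laplace (f * g) = f * laplace g + g * laplace f - (2 : ℝ) • gradInner f g := by
  ext x
  have hx := coe_ne_zero x
  have h1 : ∀ i, pd i (pd i (homExt (f * g))) (x : Amb n) =
      f x * pd i (pd i (homExt g)) (x : Amb n) + g x * pd i (pd i (homExt f)) (x : Amb n) +
        2 * (pd i (homExt f) (x : Amb n) * pd i (homExt g) (x : Amb n)) := by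
    intro i
    have h2 : pd i (homExt (f * g)) =ᶠ[nhds (x : Amb n)]
        homExt f * pd i (homExt g) + homExt g * pd i (homExt f) := by
      filter_upwards [eventually_ne_zero hx] with y hy
      exact pd_mul i (differentiableAt_homExt hf hy) (differentiableAt_homExt hg hy)
    have df := differentiableAt_homExt hf hx
    have dg := differentiableAt_homExt hg hx
    have df' := (contDiffAt_pd i (contDiffAt_homExt hf hx)).differentiableAt (by simp)
    have dg' := (contDiffAt_pd i (contDiffAt_homExt hg hx)).differentiableAt (by simp)
    have h3 : pd i (pd i (homExt (f * g))) (x : Amb n) =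
        pd i (homExt f * pd i (homExt g)) (x : Amb n) +
          pd i (homExt g * pd i (homExt f)) (x : Amb n) := by
      conv_lhs => rw [pd, h2.fderiv_eq, fderiv_add (df.mul dg') (dg.mul df')]
      rfl
    rw [h3, pd_mul i df dg', pd_mul i dg df', homExt_coe, homExt_coe]
    ring
  simp only [laplace_eq (mul_mem hf hg), Pi.sub_apply, Pi.add_apply, Pi.mul_apply, Pi.smul_apply,
    smul_eq_mul, laplace_eq hf, laplace_eq hg, gradInner, h1, Finset.sum_add_distrib,
    Finset.mul_sum]
  simp only [← Finset.mul_sum]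
  ring

/-- The coordinate functions on the sphere. -/
def coord (i : Fin (n + 1)) : Sph n → ℝ := fun x => (x : Amb n) i

theorem coord_mem_smoothFun (i : Fin (n + 1)) : coord i ∈ smoothFun n := by
  have := Fact.mk (@finrank_euclideanSpace_fin ℝ _ (n + 1))
  have h1 : ContMDiff (𝓡 n) 𝓘(ℝ, Amb n) ∞ ((↑) : Sph n → Amb n) := contMDiff_coe_sphere
  exact (EuclideanSpace.proj i : Amb n →L[ℝ] ℝ).contMDiff.comp h1

theorem hasFDerivAt_homExt_coord (i : Fin (n + 1)) (x : Sph n) :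
    HasFDerivAt (homExt (coord i)) ((EuclideanSpace.proj i : Amb n →L[ℝ] ℝ) ∘L
      (ContinuousLinearMap.id ℝ (Amb n) -
        (innerSL ℝ (x : Amb n)).smulRight (x : Amb n))) (x : Amb n) :=
  (EuclideanSpace.proj i : Amb n →L[ℝ] ℝ).hasFDerivAt.comp (x : Amb n)
    (hasFDerivAt_radial x)

theorem pd_homExt_coord (i j : Fin (n + 1)) (x : Sph n) :
    pd j (homExt (coord i)) (x : Amb n) = (if i = j then 1 else 0) - coord i x * coord j x := by
  rw [pd, (hasFDerivAt_homExt_coord i x).fderiv]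
  simp [coord, EuclideanSpace.inner_single_right, mul_comm]

theorem sum_coord_sq (x : Sph n) : ∑ i, coord i x ^ 2 = 1 := by
  have hx : ‖(x : Amb n)‖ = 1 := norm_eq_of_mem_sphere x
  have h := EuclideanSpace.norm_sq_eq (x : Amb n)
  rw [hx] at h
  simpa [coord] using h.symm

theorem gradInner_coord (i j : Fin (n + 1)) :
    gradInner (coord (n := n) i) (coord j) = (if i = j then 1 else 0) - coord i * coord j := by
  ext x
  have h : ∀ k, ((if i = k then 1 else 0) - coord i x * coord k x) *
      ((if j = k then 1 else 0) - coord j x * coord k x) =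
      (if i = k then (if j = k then 1 else 0) - coord j x * coord k x else 0) -
      (if j = k then coord i x * coord k x else 0) + coord i x * coord j x * coord k x ^ 2 := by
    intro k
    split_ifs <;> ring
  simp only [gradInner, pd_homExt_coord, h, Finset.sum_add_distrib, Finset.sum_sub_distrib,
    ← Finset.mul_sum, sum_coord_sq]
  by_cases hij : i = j
  · subst hij
    simp
  · simp [hij, Ne.symm hij]
    ring

/-- The gradient of `xᵢ` is the tangential part of `eᵢ`, namely `eᵢ - xᵢ x`. Its covariant
derivative is `-xᵢ` times the identity of an `n`-dimensional space. -/
theorem laplace_coord (i : Fin (n + 1)) : laplace (coord (n := n) i) = (n : ℝ) • coord i := by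
  ext x
  have h1 : ∀ z : Sph n, (grad (coord i) z : Amb n) =
      EuclideanSpace.single i 1 - (z : Amb n) i • (z : Amb n) := by
    intro z
    refine ext_inner_right ℝ fun u => ?_
    rw [coe_grad (coord_mem_smoothFun i), InnerProductSpace.toDual_symm_apply]
    change fderiv ℝ (homExt (coord i)) _ u = _
    rw [(hasFDerivAt_homExt_coord i z).fderiv]
    simp [inner_sub_left, inner_smul_left, EuclideanSpace.inner_single_left]
    ring
  have h2 := ((hasFDerivAt_const (EuclideanSpace.single i (1 : ℝ)) (x : Amb n)).sub
    ((hasFDerivAt_homExt_coord i x).smul (hasFDerivAt_radial x))).congr_of_eventuallyEq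
      (f₁ := fun y => (grad (coord i) (radial y) : Amb n))
      (Filter.Eventually.of_forall fun y => h1 _)
  have hx : ‖(x : Amb n)‖ = 1 := norm_eq_of_mem_sphere x
  have h3 : (covDeriv (grad (coord i)) x : Tan x →ₗ[ℝ] Tan x) =
      (-coord i x) • LinearMap.id := by
    refine LinearMap.ext fun v => Subtype.ext ?_
    have hv : inner ℝ (x : Amb n) (v : Amb n) = 0 :=
      Submodule.mem_orthogonal_singleton_iff_inner_right.1 v.2
    simp only [covDeriv, dSph, h2.fderiv, ContinuousLinearMap.coe_coe,
      ContinuousLinearMap.comp_apply, coe_proj_tan]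
    simp [hv, homExt_coe, radial_coe, inner_add_right,
      inner_neg_right, inner_smul_right, coord]
  have h4 : Module.finrank ℝ (Tan x) = n := by
    have := Fact.mk (@finrank_euclideanSpace_fin ℝ _ (n + 1))
    exact Submodule.finrank_orthogonal_span_singleton (coe_ne_zero x)
  rw [laplace, divg, h3, map_smul, LinearMap.trace_id, h4]
  simp
  ring

/-! ### The degree filtration and the triangular action of the Laplacian -/

/-- The monomial functions on the sphere. -/
def mono (α : Fin (n + 1) →₀ ℕ) : Sph n → ℝ := ∏ i, coord i ^ α i

/-- The functions on the sphere given by polynomials of degree less than `k`. -/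
def polyLT (n k : ℕ) : Submodule ℝ (Sph n → ℝ) :=
  Submodule.span ℝ (mono '' {α | α.degree < k})

theorem mono_zero : mono (0 : Fin (n + 1) →₀ ℕ) = 1 := by
  simp [mono]

theorem mono_add_single (α : Fin (n + 1) →₀ ℕ) (i : Fin (n + 1)) :
    mono (α + Finsupp.single i 1) = coord i * mono α := by
  simp only [mono, Finsupp.add_apply, pow_add, Finset.prod_mul_distrib]
  rw [mul_comm]
  congr 1
  rw [Finset.prod_eq_single i] <;> simp +contextual [eq_comm]

theorem mono_mem_polyLT {α : Fin (n + 1) →₀ ℕ} {k : ℕ} (h : α.degree < k) :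
    mono α ∈ polyLT n k :=
  Submodule.subset_span ⟨α, h, rfl⟩

theorem mono_mem_smoothFun (α : Fin (n + 1) →₀ ℕ) : mono α ∈ smoothFun n :=
  prod_mem fun i _ => pow_mem (coord_mem_smoothFun i) _

theorem polyLT_le_smoothFun {k : ℕ} {q : Sph n → ℝ} (hq : q ∈ polyLT n k) :
    q ∈ smoothFun n := by
  have : polyLT n k ≤ (smoothFun n).toSubmodule := by
    rw [polyLT, Submodule.span_le]
    rintro _ ⟨α, -, rfl⟩
    exact mono_mem_smoothFun α
  exact this hq

theorem polyLT_mono {k l : ℕ} (h : k ≤ l) : polyLT n k ≤ polyLT n l :=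
  Submodule.span_mono (Set.image_mono fun _ hα => lt_of_lt_of_le hα h)

theorem polyLT_zero : polyLT n 0 = ⊥ := by
  simp [polyLT]

theorem coord_mul_mem_polyLT {k : ℕ} {q : Sph n → ℝ} (hq : q ∈ polyLT n k) (i : Fin (n + 1)) :
    coord i * q ∈ polyLT n (k + 1) := by
  have : polyLT n k ≤ (polyLT n (k + 1)).comap (LinearMap.mulLeft ℝ (coord i)) := by
    rw [polyLT, Submodule.span_le]
    rintro _ ⟨α, hα, rfl⟩
    change coord i * mono α ∈ polyLT n (k + 1)
    rw [← mono_add_single]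
    refine mono_mem_polyLT ?_
    have : α.degree < k := hα
    simp only [map_add, Finsupp.degree_single]
    omega
  exact this hq

@[elab_as_elim]
theorem finsupp_induction_add_single {σ : Type*} {p : (σ →₀ ℕ) → Prop} (α : σ →₀ ℕ) (zero : p 0)
    (add : ∀ α i, p α → p (α + Finsupp.single i 1)) : p α := by
  generalize hd : α.degree = d
  induction d generalizing α with
  | zero =>
    rw [(Finsupp.degree_eq_zero_iff α).1 hd]
    exact zero
  | succ d ih =>
    have hα : α ≠ 0 := by
      rintro rfl
      simp at hd
    obtain ⟨i, hi⟩ := Finsupp.ne_iff.1 hα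
    have h1 : α - Finsupp.single i 1 + Finsupp.single i 1 = α :=
      tsub_add_cancel_of_le (Finsupp.single_le_iff.2 (Nat.one_le_iff_ne_zero.2 hi))
    rw [← h1]
    refine add _ _ (ih _ ?_)
    have h2 := congrArg Finsupp.degree h1
    rw [map_add, Finsupp.degree_single, hd] at h2
    omega

theorem gradInner_one (f : Sph n → ℝ) : gradInner f 1 = 0 := by
  ext x
  have h : homExt (1 : Sph n → ℝ) = fun _ => 1 := rfl
  simp [gradInner, h, pd]

theorem laplace_one : laplace (1 : Sph n → ℝ) = 0 := by
  ext x
  have h : homExt (1 : Sph n → ℝ) = fun _ => 1 := rfl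
  have h' (i : Fin (n + 1)) : pd i (homExt (1 : Sph n → ℝ)) = fun _ => 0 := by
    ext y
    simp [h, pd]
  rw [laplace_eq (one_mem _)]
  simp only [h']
  simp [pd]

/-- By the Leibniz rule each of the `|α|` factors `xⱼ` contributes `δᵢⱼ - xᵢ xⱼ` in place of `xⱼ`;
the `δᵢⱼ` terms have lower degree. -/
theorem gradInner_coord_mono (α : Fin (n + 1) →₀ ℕ) (i : Fin (n + 1)) :
    gradInner (coord i) (mono α) + (α.degree : ℝ) • (coord i * mono α) ∈
      polyLT n (α.degree + 1) := by
  induction α using finsupp_induction_add_single with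
  | zero => simp [mono_zero, gradInner_one]
  | add α j ih =>
    have h1 : (if i = j then (1 : Sph n → ℝ) else 0) * mono α ∈ polyLT n (α.degree + 1 + 1) := by
      split_ifs
      · rw [one_mul]
        exact mono_mem_polyLT (by omega)
      · simp
    have h2 := add_mem (coord_mul_mem_polyLT ih j) h1
    rw [mono_add_single, map_add, Finsupp.degree_single,
      gradInner_mul (coord_mem_smoothFun j) (mono_mem_smoothFun α), gradInner_coord]
    convert! h2 using 1
    ext x
    simp only [Pi.add_apply, Pi.mul_apply, Pi.sub_apply, Pi.smul_apply, smul_eq_mul]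
    push_cast
    ring

theorem laplace_mono (α : Fin (n + 1) →₀ ℕ) :
    laplace (mono α) - v n α.degree • mono α ∈ polyLT n α.degree := by
  induction α using finsupp_induction_add_single with
  | zero => simp [mono_zero, laplace_one, v]
  | add α i ih =>
    -- With `d = |α|`, the terms `v_d`, `n` (from `laplace_coord`) and `2d` (from the gradient term)
    -- add up to `v_{d+1}`.
    have h := sub_mem (coord_mul_mem_polyLT ih i)
      (Submodule.smul_mem _ (2 : ℝ) (gradInner_coord_mono α i))
    rw [mono_add_single, map_add, Finsupp.degree_single,
      laplace_mul (coord_mem_smoothFun i) (mono_mem_smoothFun α), laplace_coord]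
    convert! h using 1
    ext x
    simp [v]
    ring

/-- The Laplace operator on smooth functions as a linear map. -/
def laplaceₗ (n : ℕ) : (smoothFun n).toSubmodule →ₗ[ℝ] (Sph n → ℝ) where
  toFun f := laplace f.1
  map_add' f g := by
    ext x
    exact laplace_add f.2 g.2 x
  map_smul' c f := by
    ext x
    exact laplace_smul f.2 c x

theorem laplace_sub_smul_mem_polyLT {m : ℕ} {q : Sph n → ℝ} (hq : q ∈ polyLT n (m + 1)) :
    laplace q - v n m • q ∈ polyLT n m := by
  -- The Laplacian is known to be linear only on smooth functions, so the span argument is run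
  -- inside `smoothFun n` and then mapped out.
  let T := laplaceₗ n - v n m • (smoothFun n).toSubmodule.subtype
  have h : polyLT n (m + 1) ≤
      ((polyLT n m).comap T).map (smoothFun n).toSubmodule.subtype := by
    conv_lhs => rw [polyLT]
    rw [Submodule.span_le]
    rintro _ ⟨α, hα, rfl⟩
    refine ⟨⟨mono α, mono_mem_smoothFun α⟩, ?_, rfl⟩
    change laplace (mono α) - v n m • mono α ∈ polyLT n m
    have h1 := laplace_mono α
    rcases (Nat.lt_succ_iff.1 hα).lt_or_eq with hlt | heq
    · have h2 : mono α ∈ polyLT n m := mono_mem_polyLT hlt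
      have h3 := add_mem (polyLT_mono hlt.le h1) (Submodule.smul_mem _ (v n α.degree) h2)
      rw [sub_add_cancel] at h3
      exact sub_mem h3 (Submodule.smul_mem _ _ h2)
    · rwa [heq] at h1
  obtain ⟨q', h1, rfl⟩ := h hq
  exact h1

theorem laplace_mem_polyLT {k : ℕ} {q : Sph n → ℝ} (hq : q ∈ polyLT n k) :
    laplace q ∈ polyLT n k := by
  have h := laplace_sub_smul_mem_polyLT (polyLT_mono k.le_succ hq)
  simpa using add_mem h (Submodule.smul_mem _ (v n k) hq)

instance (n k : ℕ) : FiniteDimensional ℝ (polyLT n k) := by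
  refine FiniteDimensional.span_of_finite ℝ (Set.Finite.image _ ?_)
  exact (Finsupp.finite_of_degree_le k).subset fun α (hα : α.degree < k) => hα.le

theorem v_strictMono (hn : 0 < n) : StrictMono (v n) := by
  refine strictMono_nat_of_lt_succ fun k => ?_
  have : (0 : ℝ) < n := by exact_mod_cast hn
  simp only [v]
  push_cast
  nlinarith [(Nat.cast_nonneg k : (0 : ℝ) ≤ k)]

/-! ### Symmetry of the Laplacian by integration by parts in `ℝ^{n+1}` -/

/-- A bump function on `ℝ`, supported in `[1, 3]`. -/
def bump : ContDiffBump (2 : ℝ) := ⟨1 / 2, 1, by norm_num, by norm_num⟩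

/-- A radial smooth cutoff function on `ℝ^{n+1}`, supported in an annulus. -/
def cutoff (n : ℕ) : Amb n → ℝ := fun y => bump (‖y‖ ^ 2)

theorem contDiff_cutoff : ContDiff ℝ ∞ (cutoff n) :=
  bump.contDiff.comp (contDiff_norm_sq ℝ)

theorem tsupport_cutoff_subset :
    tsupport (cutoff n) ⊆ {y | 1 ≤ ‖y‖ ^ 2 ∧ ‖y‖ ^ 2 ≤ 3} := by
  refine closure_minimal ?_ ?_
  · intro y hy
    have h : ‖y‖ ^ 2 ∈ Function.support bump := hy
    rw [bump.support_eq, Real.ball_eq_Ioo] at h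
    have h1 : (2 : ℝ) - 1 < ‖y‖ ^ 2 := h.1
    have h2 : ‖y‖ ^ 2 < 2 + 1 := h.2
    constructor <;> linarith
  · have hc : Continuous fun y : Amb n => ‖y‖ ^ 2 := by fun_prop
    exact (isClosed_le continuous_const hc).inter (isClosed_le hc continuous_const)

theorem hasCompactSupport_cutoff : HasCompactSupport (cutoff n) := by
  refine IsCompact.of_isClosed_subset (isCompact_closedBall (0 : Amb n) 2) (isClosed_tsupport _) ?_
  intro y hy
  rw [mem_closedBall_zero_iff]
  nlinarith [(tsupport_cutoff_subset hy).2]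

theorem ne_zero_of_mem_tsupport_cutoff {y : Amb n} (hy : y ∈ tsupport (cutoff n)) : y ≠ 0 := by
  rintro rfl
  have := (tsupport_cutoff_subset hy).1
  norm_num at this

theorem integrable_of_tsupport_subset {K : Amb n → ℝ} (hK : ∀ y ≠ 0, ContinuousAt K y)
    (hs : tsupport K ⊆ tsupport (cutoff n)) : MeasureTheory.Integrable K := by
  have h1 : Continuous K :=
    continuous_of_tsupport fun y hy => hK y (ne_zero_of_mem_tsupport_cutoff (hs hy))
  exact h1.integrable_of_hasCompactSupport
    (IsCompact.of_isClosed_subset hasCompactSupport_cutoff (isClosed_tsupport _) hs)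

theorem pd_cutoff (i : Fin (n + 1)) (y : Amb n) :
    pd i (cutoff n) y = 2 * deriv bump (‖y‖ ^ 2) * y i := by
  have h1 : HasFDerivAt (fun y : Amb n => ‖y‖ ^ 2) (2 • innerSL ℝ y) y :=
    (hasStrictFDerivAt_norm_sq y).hasFDerivAt
  have h2 : HasDerivAt bump (deriv bump (‖y‖ ^ 2)) (‖y‖ ^ 2) :=
    (bump.contDiff (n := 1)).differentiable (by simp) |>.differentiableAt.hasDerivAt
  have h3 := h2.comp_hasFDerivAt y h1
  have h4 : pd i (cutoff n) y = fderiv ℝ (bump ∘ fun y : Amb n => ‖y‖ ^ 2) y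
    (EuclideanSpace.single i 1) := rfl
  rw [h4, h3.fderiv]
  simp [EuclideanSpace.inner_single_right]
  ring

/-- The gradient of a radial function is parallel to `y`, and the extension has zero derivative in
that direction. -/
theorem sum_pd_cutoff_mul_pd {f : Sph n → ℝ} (hf : f ∈ smoothFun n) {y : Amb n} (hy : y ≠ 0) :
    ∑ i, pd i (cutoff n) y * pd i (homExt f) y = 0 := by
  have h5 : ∑ i, y i • EuclideanSpace.single i (1 : ℝ) = y := by
    have := (EuclideanSpace.basisFun (Fin (n + 1)) ℝ).sum_repr y
    simpa using this
  have h6 : ∑ i, y i * pd i (homExt f) y = 0 := by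
    have h := fderiv_homExt_self hf hy
    nth_rewrite 2 [← h5] at h
    simpa only [map_sum, map_smul, smul_eq_mul, pd] using h
  simp only [pd_cutoff, mul_assoc, ← Finset.mul_sum, h6, mul_zero]

/-- The cutoff vanishes near the origin, where the extensions are singular, and has compact support,
so there are no boundary terms. Its own derivatives drop out because they are radial. The right-hand
side is symmetric in `f` and `g`. -/
theorem integral_cutoff_mul_pd_pd {f g : Sph n → ℝ} (hf : f ∈ smoothFun n)
    (hg : g ∈ smoothFun n) :
    ∫ y, cutoff n y * homExt g y * ∑ i, pd i (pd i (homExt f)) y =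
      -∫ y, cutoff n y * ∑ i, pd i (homExt f) y * pd i (homExt g) y := by
  have hts : tsupport (cutoff n * homExt g) ⊆ tsupport (cutoff n) := tsupport_mul_subset_left
  have hcG : ∀ y ≠ 0, ContDiffAt ℝ ∞ (cutoff n * homExt g) y := fun y hy =>
    contDiff_cutoff.contDiffAt.mul (contDiffAt_homExt hg hy)
  have hI1 : ∀ i, MeasureTheory.Integrable fun y =>
      (cutoff n * homExt g) y * pd i (pd i (homExt f)) y := fun i =>
    integrable_of_tsupport_subset (fun y hy => (hcG y hy).continuousAt.mul
      (contDiffAt_pd i (contDiffAt_pd i (contDiffAt_homExt hf hy))).continuousAt)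
      (tsupport_mul_subset_left.trans hts)
  have hI2 : ∀ i, MeasureTheory.Integrable fun y =>
      pd i (cutoff n * homExt g) y * pd i (homExt f) y := fun i =>
    integrable_of_tsupport_subset (fun y hy => (contDiffAt_pd i (hcG y hy)).continuousAt.mul
      (contDiffAt_pd i (contDiffAt_homExt hf hy)).continuousAt)
      (tsupport_mul_subset_left.trans ((tsupport_fderiv_apply_subset ℝ _).trans hts))
  have hI3 : ∀ i, MeasureTheory.Integrable fun y =>
      (cutoff n * homExt g) y * pd i (homExt f) y := fun i =>
    integrable_of_tsupport_subset (fun y hy => (hcG y hy).continuousAt.mul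
      (contDiffAt_pd i (contDiffAt_homExt hf hy)).continuousAt)
      (tsupport_mul_subset_left.trans hts)
  have hdiff : ∀ y, DifferentiableAt ℝ (cutoff n * homExt g) y := by
    intro y
    by_cases hy : y = 0
    · have h0 : y ∉ tsupport (cutoff n * homExt g) := fun h =>
        ne_zero_of_mem_tsupport_cutoff (hts h) hy
      exact (differentiableAt_const (0 : ℝ)).congr_of_eventuallyEq
        (notMem_tsupport_iff_eventuallyEq.1 h0)
    · exact (hcG y hy).differentiableAt (by simp)
  have hibp : ∀ i, ∫ y, (cutoff n * homExt g) y * pd i (pd i (homExt f)) y =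
      -∫ y, pd i (cutoff n * homExt g) y * pd i (homExt f) y := fun i =>
    integral_mul_fderiv_eq_neg_fderiv_mul_of_integrable (hI2 i) (hI1 i) (hI3 i)
      (fun y _ => hdiff y) fun y hy =>
        (contDiffAt_pd i (contDiffAt_homExt hf
          (ne_zero_of_mem_tsupport_cutoff (hts hy)))).differentiableAt (by simp)
  have h1 : ∫ y, cutoff n y * homExt g y * ∑ i, pd i (pd i (homExt f)) y =
      ∑ i, ∫ y, (cutoff n * homExt g) y * pd i (pd i (homExt f)) y := by
    rw [← MeasureTheory.integral_finsetSum _ fun i _ => hI1 i]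
    simp [Finset.mul_sum]
  rw [h1, Finset.sum_congr rfl fun i _ => hibp i, Finset.sum_neg_distrib,
    ← MeasureTheory.integral_finsetSum _ fun i _ => hI2 i]
  congr 1
  refine MeasureTheory.integral_congr_ae ?_
  filter_upwards [MeasureTheory.Measure.ae_ne MeasureTheory.volume (0 : Amb n)] with y hy
  have h2 := sum_pd_cutoff_mul_pd hf hy
  have h3 : ∀ i, pd i (cutoff n * homExt g) y * pd i (homExt f) y =
      cutoff n y * (pd i (homExt f) y * pd i (homExt g) y) +
        homExt g y * (pd i (cutoff n) y * pd i (homExt f) y) := by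
    intro i
    rw [pd_mul i (contDiff_cutoff.contDiffAt.differentiableAt (by simp))
      (differentiableAt_homExt hg hy)]
    ring
  simp only [h3, Finset.sum_add_distrib, ← Finset.mul_sum, h2, mul_zero, add_zero]

theorem pd_comp_smul (i : Fin (n + 1)) (H : Amb n → ℝ) (t : ℝ) (y : Amb n) :
    pd i (fun z => H (t • z)) y = t * pd i H (t • y) := by
  simp [pd, fderiv_comp_smul]

/-- Each derivative lowers the degree of homogeneity by one, from `0` to `-2`. -/
theorem pd_pd_homExt (i : Fin (n + 1)) (f : Sph n → ℝ) {t : ℝ} (ht : 0 < t) (y : Amb n) :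
    pd i (pd i (homExt f)) y = t ^ 2 * pd i (pd i (homExt f)) (t • y) := by
  have h1 : homExt f = fun z => homExt f (t • z) := by
    ext z
    simp only [homExt, radial_smul ht]
  have h2 : pd i (homExt f) = t • fun z => pd i (homExt f) (t • z) := by
    ext z
    conv_lhs => rw [h1]
    rw [pd_comp_smul, Pi.smul_apply, smul_eq_mul]
  conv_lhs => rw [h2]
  have h3 : pd i (t • fun z => pd i (homExt f) (t • z)) y =
      t * pd i (fun z => pd i (homExt f) (t • z)) y := by
    simp [pd, fderiv_const_smul_field]
  rw [h3, pd_comp_smul]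
  ring

theorem sum_pd_pd_homExt {f : Sph n → ℝ} (hf : f ∈ smoothFun n) {y : Amb n} (hy : y ≠ 0) :
    ∑ i, pd i (pd i (homExt f)) y = -((‖y‖ ^ 2)⁻¹ * laplace f (radial y)) := by
  have ht : 0 < ‖y‖⁻¹ := inv_pos.2 (norm_pos_iff.2 hy)
  rw [laplace_eq hf, coe_radial hy, mul_neg, neg_neg, Finset.mul_sum]
  refine Finset.sum_congr rfl fun i _ => ?_
  rw [pd_pd_homExt i f ht y, inv_pow]

open MeasureTheory in
/-- Weighted integrals over `ℝ^{n+1}` of `0`-homogeneous functions are proportional to integrals over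
the sphere. -/
theorem exists_integral_homExt_eq (n : ℕ) : ∃ C : ℝ, C ≠ 0 ∧ ∀ h : Sph n → ℝ,
    ∫ y, cutoff n y * ((‖y‖ ^ 2)⁻¹ * h (radial y)) =
      C * ∫ x, h x ∂(volume : Measure (Amb n)).toSphere := by
  let σ := (volume : Measure (Amb n)).toSphere
  let ρ := Measure.volumeIoiPow (Module.finrank ℝ (Amb n) - 1)
  let u : ℝ → ℝ := fun r => bump (r ^ 2) * (r ^ 2)⁻¹
  have key : ∀ h : Sph n → ℝ, ∫ y, cutoff n y * ((‖y‖ ^ 2)⁻¹ * h (radial y)) =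
      (∫ r, u r ∂ρ) * ∫ x, h x ∂σ := by
    intro h
    -- After removing the origin, a null set, polar coordinates split the integrand into `h` times a
    -- radial weight.
    calc ∫ y, cutoff n y * ((‖y‖ ^ 2)⁻¹ * h (radial y))
        = ∫ y : ({0}ᶜ : Set (Amb n)), cutoff n y.1 * ((‖y.1‖ ^ 2)⁻¹ * h (radial y.1))
            ∂(Measure.comap Subtype.val volume) := by
          rw [integral_subtype_comap (measurableSet_singleton _).compl
            fun y : Amb n => cutoff n y * ((‖y‖ ^ 2)⁻¹ * h (radial y)), restrict_compl_singleton]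
      _ = ∫ z, h z.1 * u z.2 ∂(σ.prod ρ) := by
          rw [← (volume : Measure (Amb n)).measurePreserving_homeomorphUnitSphereProd.integral_comp
            (Homeomorph.measurableEmbedding _)]
          refine integral_congr_ae (Filter.Eventually.of_forall fun y => ?_)
          have hy : (y : Amb n) ≠ 0 := y.2
          have h1 : (homeomorphUnitSphereProd (Amb n) y).1 = radial (y : Amb n) := by
            apply Subtype.ext
            rw [coe_radial hy]
            simp
          have h2 : ((homeomorphUnitSphereProd (Amb n) y).2 : ℝ) = ‖(y : Amb n)‖ := by
            simp
          simp only [h1, h2, u, cutoff]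
          ring
      _ = _ := by
          rw [integral_prod_mul h fun r : Set.Ioi (0 : ℝ) => u r, mul_comm]
  refine ⟨∫ r, u r ∂ρ, fun h0 => ?_, key⟩
  -- If the constant were `0`, the case `h = 1` would make the integral of a nonnegative continuous
  -- function vanish, although that function is positive at radius `√2`, the centre of the bump.
  have h1 := key 1
  rw [h0, zero_mul] at h1
  have h2 : Continuous fun y : Amb n => cutoff n y * ((‖y‖ ^ 2)⁻¹ * 1) := by
    refine continuous_of_tsupport fun y hy => ?_
    have hy0 : y ≠ 0 := ne_zero_of_mem_tsupport_cutoff (tsupport_mul_subset_left hy)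
    exact contDiff_cutoff.continuous.continuousAt.mul
      (((continuous_norm.pow 2).continuousAt.inv₀ (by simpa using hy0)).mul continuousAt_const)
  have h3 : HasCompactSupport fun y : Amb n => cutoff n y * ((‖y‖ ^ 2)⁻¹ * 1) :=
    hasCompactSupport_cutoff.mul_right
  have h4 := h2.integral_pos_of_hasCompactSupport_nonneg_nonzero (μ := volume)
    (x := √2 • (basePoint n : Amb n)) h3
    (fun y => mul_nonneg bump.nonneg (by positivity)) (by
      have hb : ‖(basePoint n : Amb n)‖ = 1 := norm_eq_of_mem_sphere _
      have hn : ‖√2 • (basePoint n : Amb n)‖ ^ 2 = 2 := by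
        rw [norm_smul, hb]
        simp
      have : bump (2 : ℝ) = 1 := bump.one_of_mem_closedBall (by simp [bump])
      simp [cutoff, hn, this])
  exact h4.ne' h1

/-- The Laplace operator is symmetric. -/
theorem integral_mul_laplace_comm {f g : Sph n → ℝ} (hf : f ∈ smoothFun n)
    (hg : g ∈ smoothFun n) :
    ∫ x, g x * laplace f x ∂(MeasureTheory.volume : MeasureTheory.Measure (Amb n)).toSphere =
      ∫ x, f x * laplace g x
        ∂(MeasureTheory.volume : MeasureTheory.Measure (Amb n)).toSphere := by
  obtain ⟨C, hC, h⟩ := exists_integral_homExt_eq n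
  have key : ∀ {f g : Sph n → ℝ}, f ∈ smoothFun n → g ∈ smoothFun n →
      C * ∫ x, g x * laplace f x
        ∂(MeasureTheory.volume : MeasureTheory.Measure (Amb n)).toSphere =
      ∫ y, cutoff n y * ∑ i, pd i (homExt f) y * pd i (homExt g) y := by
    intro f g hf hg
    rw [← h fun x => g x * laplace f x, ← neg_inj, ← integral_cutoff_mul_pd_pd hf hg,
      ← MeasureTheory.integral_neg]
    refine MeasureTheory.integral_congr_ae ?_
    filter_upwards [MeasureTheory.Measure.ae_ne MeasureTheory.volume (0 : Amb n)] with y hy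
    rw [sum_pd_pd_homExt hf hy, homExt]
    ring
  refine mul_left_cancel₀ hC ?_
  rw [key hf hg, key hg hf]
  simp only [mul_comm]

/-! ### Square-integrable functions and density of polynomials -/

/-- The surface measure of the sphere. -/
abbrev surf (n : ℕ) : MeasureTheory.Measure (Sph n) :=
  (MeasureTheory.volume : MeasureTheory.Measure (Amb n)).toSphere

/-- Smooth functions as continuous functions. -/
def toCont (n : ℕ) : (smoothFun n).toSubmodule →ₗ[ℝ] C(Sph n, ℝ) where
  toFun f := ⟨f.1, ContMDiff.continuous f.2⟩
  map_add' _ _ := rfl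
  map_smul' _ _ := rfl

/-- Smooth functions as square integrable functions. -/
def toL2 (n : ℕ) : (smoothFun n).toSubmodule →ₗ[ℝ] MeasureTheory.Lp ℝ 2 (surf n) :=
  (ContinuousMap.toLp 2 (surf n) ℝ : C(Sph n, ℝ) →L[ℝ] _).toLinearMap ∘ₗ toCont n

theorem inner_toL2 (f g : (smoothFun n).toSubmodule) :
    inner ℝ (toL2 n f) (toL2 n g) = ∫ x, f.1 x * g.1 x ∂surf n := by
  have h := MeasureTheory.ContinuousMap.inner_toLp (𝕜 := ℝ) (μ := surf n) (toCont n f) (toCont n g)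
  refine Eq.trans h ?_
  simp [toCont, mul_comm]

theorem toL2_injective : Function.Injective (toL2 n) := by
  refine (ContinuousMap.toLp_injective (p := 2) (𝕜 := ℝ) (surf n)).comp fun f g h => ?_
  exact Subtype.ext (congrArg DFunLike.coe h)

theorem mono_mul_mono (α β : Fin (n + 1) →₀ ℕ) : mono α * mono β = mono (α + β) := by
  simp [mono, pow_add, Finset.prod_mul_distrib]

theorem mul_mem_polyLT {j k : ℕ} {p q : Sph n → ℝ} (hp : p ∈ polyLT n j) (hq : q ∈ polyLT n k) :
    p * q ∈ polyLT n (j + k) := by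
  have h := Submodule.mul_mem_mul hp hq
  rw [polyLT, polyLT, Submodule.span_mul_span] at h
  refine Submodule.span_mono ?_ h
  rintro _ ⟨_, ⟨α, hα, rfl⟩, _, ⟨β, hβ, rfl⟩, rfl⟩
  refine ⟨α + β, ?_, (mono_mul_mono α β).symm⟩
  have h1 : α.degree < j := hα
  have h2 : β.degree < k := hβ
  simp only [Set.mem_ofPred_eq, map_add]
  omega

theorem exists_mem_polyLT_of_mem_adjoin {a : C(Sph n, ℝ)}
    (ha : a ∈ Algebra.adjoin ℝ
      (Set.range fun i => toCont n ⟨coord i, coord_mem_smoothFun i⟩)) :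
    ∃ k, (a : Sph n → ℝ) ∈ polyLT n k := by
  have h1 : (1 : Sph n → ℝ) ∈ polyLT n 1 := by
    rw [← mono_zero]
    exact mono_mem_polyLT (by simp)
  induction ha using Algebra.adjoin_induction with
  | mem a h =>
    obtain ⟨i, rfl⟩ := h
    refine ⟨2, ?_⟩
    have := coord_mul_mem_polyLT h1 i
    rwa [mul_one] at this
  | algebraMap r =>
    refine ⟨1, ?_⟩
    have := Submodule.smul_mem _ r h1
    convert! this using 1
    ext x
    simp
  | add a b _ _ ha hb =>
    obtain ⟨j, hj⟩ := ha
    obtain ⟨k, hk⟩ := hb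
    exact ⟨max j k, add_mem (polyLT_mono (le_max_left j k) hj) (polyLT_mono (le_max_right j k) hk)⟩
  | mul a b _ _ ha hb =>
    obtain ⟨j, hj⟩ := ha
    obtain ⟨k, hk⟩ := hb
    exact ⟨j + k, mul_mem_polyLT hj hk⟩

/-- A smooth function orthogonal to all polynomials vanishes. -/
theorem eq_zero_of_forall_polyLT (g : (smoothFun n).toSubmodule)
    (h : ∀ k, ∀ q : (smoothFun n).toSubmodule, q.1 ∈ polyLT n k →
      inner ℝ (toL2 n g) (toL2 n q) = 0) : g = 0 := by
  let A : Subalgebra ℝ C(Sph n, ℝ) := Algebra.adjoin ℝ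
      (Set.range fun i => toCont n ⟨coord i, coord_mem_smoothFun i⟩)
  have hA : A.SeparatesPoints := by
    intro x y hxy
    obtain ⟨i, hi⟩ : ∃ i, (x : Amb n) i ≠ (y : Amb n) i := by
      by_contra! hc
      exact hxy (Subtype.ext (PiLp.ext hc))
    exact ⟨_, ⟨_, Algebra.subset_adjoin ⟨i, rfl⟩, rfl⟩, hi⟩
  have htop := ContinuousMap.subalgebra_topologicalClosure_eq_top_of_separatesPoints A hA
  let J : C(Sph n, ℝ) →L[ℝ] MeasureTheory.Lp ℝ 2 (surf n) := ContinuousMap.toLp 2 (surf n) ℝ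
  -- Uniform convergence implies `L²` convergence, so orthogonality to `g` passes from polynomials
  -- to their uniform closure. That closure contains `g`, which is thus orthogonal to itself.
  have hclosed : IsClosed {a : C(Sph n, ℝ) | inner ℝ (toL2 n g) (J a) = 0} :=
    isClosed_eq (continuous_const.inner J.continuous) continuous_const
  have hsub : (A : Set C(Sph n, ℝ)) ⊆ {a | inner ℝ (toL2 n g) (J a) = 0} := by
    intro a ha
    obtain ⟨k, hk⟩ := exists_mem_polyLT_of_mem_adjoin ha
    exact h k ⟨a, polyLT_le_smoothFun hk⟩ hk
  have hg : toCont n g ∈ A.topologicalClosure := by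
    rw [htop]
    trivial
  have h0 : inner ℝ (toL2 n g) (toL2 n g) = 0 := closure_minimal hsub hclosed hg
  exact toL2_injective ((inner_self_eq_zero.1 h0).trans (map_zero _).symm)

/-! ### Eigenfunctions are polynomials -/

theorem inner_laplace_comm (f g Lf Lg : (smoothFun n).toSubmodule) (hf : laplace f.1 = Lf.1)
    (hg : laplace g.1 = Lg.1) :
    inner ℝ (toL2 n f) (toL2 n Lg) = inner ℝ (toL2 n Lf) (toL2 n g) := by
  rw [inner_toL2, inner_toL2, ← hf, ← hg, integral_mul_laplace_comm g.2 f.2]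
  simp only [mul_comm]

/-- An eigenfunction orthogonal to the polynomials of degree less than `m` is orthogonal to those of
degree `m`, unless its eigenvalue is `v n m`. -/
theorem inner_eq_zero_succ {g : (smoothFun n).toSubmodule} {μ : ℝ} (hg : laplace g.1 = μ • g.1)
    {m : ℕ} (hm : v n m ≠ μ) (h : ∀ q : (smoothFun n).toSubmodule, q.1 ∈ polyLT n m →
      inner ℝ (toL2 n g) (toL2 n q) = 0) (q : (smoothFun n).toSubmodule)
    (hq : q.1 ∈ polyLT n (m + 1)) : inner ℝ (toL2 n g) (toL2 n q) = 0 := by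
  let Lq : (smoothFun n).toSubmodule := ⟨laplace q.1, polyLT_le_smoothFun (laplace_mem_polyLT hq)⟩
  -- The function `Δq - v_m q` has lower degree, so `g` is orthogonal to it; by symmetry its inner
  -- product with `g` is `(μ - v_m) ⟨g, q⟩`.
  have h1 := h (Lq - v n m • q) (laplace_sub_smul_mem_polyLT hq)
  have h2 := inner_laplace_comm g q (μ • g) Lq hg rfl
  rw [map_sub, map_smul, inner_sub_right, inner_smul_right, h2, map_smul, inner_smul_left] at h1
  have h3 : (μ - v n m) * inner ℝ (toL2 n g) (toL2 n q) = 0 := by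
    rw [← h1]
    simp
    ring
  exact (mul_eq_zero.1 h3).resolve_left (sub_ne_zero.2 hm.symm)

/-- Eigenfunctions of the Laplace operator are polynomials. -/
theorem mem_polyLT_of_mem_eigenspace {f : Sph n → ℝ} {μ : ℝ} (hf : f ∈ eigenspace n μ) {K : ℕ}
    (hK : ∀ m, K ≤ m → v n m ≠ μ) : f ∈ polyLT n K := by
  let S := (smoothFun n).toSubmodule
  let f' : S := ⟨f, hf.1⟩
  have hLf : laplace f'.1 = μ • f'.1 := funext hf.2
  let V : Submodule ℝ S := (polyLT n K).comap S.subtype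
  have hV : FiniteDimensional ℝ V :=
    LinearEquiv.finiteDimensional (Submodule.comapSubtypeEquivOfLe
      (fun q hq => polyLT_le_smoothFun hq : polyLT n K ≤ S)).symm
  let W := V.map (toL2 n)
  -- Here `p` is the orthogonal projection of `f` to `polyLT n K`. The aim is that the remainder `f
  -- - p` is orthogonal to all polynomials.
  obtain ⟨w, hw, z, hz, hwz⟩ := W.exists_add_mem_mem_orthogonal (toL2 n f')
  obtain ⟨p, hp, rfl⟩ := hw
  have hfp : toL2 n (f' - p) = z := by
    rw [map_sub, hwz, add_sub_cancel_left]
  have horth : ∀ q : S, q.1 ∈ polyLT n K → inner ℝ (toL2 n (f' - p)) (toL2 n q) = 0 := by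
    intro q hq
    rw [hfp]
    exact Submodule.inner_left_of_mem_orthogonal (K := W) ⟨q, hq, rfl⟩ hz
  have hp' : p.1 ∈ polyLT n K := hp
  have hlap : ∀ q : Sph n → ℝ, q ∈ polyLT n K → laplace q ∈ polyLT n K := fun q hq =>
    laplace_mem_polyLT hq
  let Lp : S := ⟨laplace p.1, polyLT_le_smoothFun (hlap _ hp')⟩
  -- The Laplacian is symmetric and preserves `polyLT n K`, so projection commutes with it: the
  -- defect `r = Δp - μp` is a polynomial in that space orthogonal to itself.
  have hLp : Lp = μ • p := by
    rw [← sub_eq_zero]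
    have hr : (Lp - μ • p).1 ∈ polyLT n K := sub_mem (hlap _ hp') (Submodule.smul_mem _ μ hp')
    set r := Lp - μ • p with hr_def
    let Lr : S := ⟨laplace r.1, polyLT_le_smoothFun (hlap _ hr)⟩
    have h1 := inner_laplace_comm p r Lp Lr rfl rfl
    have h2 := inner_laplace_comm f' r (μ • f') Lr hLf rfl
    have h3 := horth r hr
    have h4 := horth Lr (hlap _ hr)
    have h5 : inner ℝ (toL2 n r) (toL2 n r) = 0 := by
      have h6 : inner ℝ (toL2 n r) (toL2 n r) =
          inner ℝ (toL2 n Lp) (toL2 n r) - μ * inner ℝ (toL2 n p) (toL2 n r) := by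
        rw [← real_inner_smul_left, ← map_smul, ← inner_sub_left, ← map_sub]
      rw [map_sub, inner_sub_left] at h3 h4
      rw [map_smul, real_inner_smul_left] at h2
      rw [h6]
      linear_combination -h1 + h2 - h4 + μ * h3
    exact toL2_injective ((inner_self_eq_zero.1 h5).trans (map_zero _).symm)
  have hg : laplace (f' - p).1 = μ • (f' - p).1 := by
    have h1 : laplaceₗ n (f' - p) = laplaceₗ n f' - laplaceₗ n p := map_sub _ _ _
    have h2 : laplaceₗ n p = μ • p.1 := congrArg Subtype.val hLp
    have h3 : laplaceₗ n f' = μ • f'.1 := hLf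
    rw [h2, h3] at h1
    refine Eq.trans h1 ?_
    rw [← smul_sub]
    rfl
  have hall : ∀ k, ∀ q : S, q.1 ∈ polyLT n (K + k) →
      inner ℝ (toL2 n (f' - p)) (toL2 n q) = 0 := by
    intro k
    induction k with
    | zero => exact horth
    | succ k ih => exact inner_eq_zero_succ hg (hK _ (Nat.le_add_right _ _)) ih
  have h0 := eq_zero_of_forall_polyLT (f' - p) fun k q hq =>
    hall k q (polyLT_mono (Nat.le_add_left _ _) hq)
  have h1 : f' = p := sub_eq_zero.1 h0
  have h2 : f = p.1 := congrArg Subtype.val h1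
  rwa [h2]

/-- Descent on the degree: modulo lower degree `Δf` is both `μ f` and `v_m f`, so the top degree
drops as long as `v_m ≠ μ`. -/
theorem eq_zero_of_mem_eigenspace {f : Sph n → ℝ} {μ : ℝ} (hf : f ∈ eigenspace n μ) {k : ℕ}
    (hk : f ∈ polyLT n k) (h : ∀ m < k, v n m ≠ μ) : f = 0 := by
  induction k with
  | zero => simpa [polyLT_zero] using hk
  | succ k ih =>
    refine ih ?_ fun m hm => h m (hm.trans k.lt_succ_self)
    have h1 := laplace_sub_smul_mem_polyLT hk
    have h2 : laplace f = μ • f := funext hf.2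
    rw [h2, ← sub_smul] at h1
    exact (Submodule.smul_mem_iff _ (sub_ne_zero.2 (h k k.lt_succ_self).symm)).1 h1

/-! ### Multiplicities and the counting function -/

theorem eigenspace_eq_bot {μ : ℝ} (h : ∀ m, v n m ≠ μ) : eigenspace n μ = ⊥ := by
  rw [eq_bot_iff, ← polyLT_zero]
  exact fun f hf => mem_polyLT_of_mem_eigenspace hf fun m _ => h m

theorem eigenspace_v_le (hn : 0 < n) (k : ℕ) : eigenspace n (v n k) ≤ polyLT n (k + 1) :=
  fun _ hf => mem_polyLT_of_mem_eigenspace hf fun _ hm => ((v_strictMono hn) hm).ne'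

theorem finrank_polyLT_succ (hn : 0 < n) (k : ℕ) :
    Module.finrank ℝ (polyLT n (k + 1)) =
      Module.finrank ℝ (polyLT n k) + Module.finrank ℝ (eigenspace n (v n k)) := by
  have hle : polyLT n (k + 1) ≤ (smoothFun n).toSubmodule := fun q hq => polyLT_le_smoothFun hq
  let T : polyLT n (k + 1) →ₗ[ℝ] (Sph n → ℝ) :=
    laplaceₗ n ∘ₗ Submodule.inclusion hle - v n k • (polyLT n (k + 1)).subtype
  have hT : ∀ q, T q = laplace q.1 - v n k • q.1 := fun q => rfl
  have hker : T.ker.map (polyLT n (k + 1)).subtype = eigenspace n (v n k) := by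
    ext f
    constructor
    · rintro ⟨q, hq, rfl⟩
      have h1 : laplace q.1 - v n k • q.1 = 0 := hq
      exact ⟨polyLT_le_smoothFun q.2, fun x => congrFun (sub_eq_zero.1 h1) x⟩
    · intro hf
      refine ⟨⟨f, eigenspace_v_le hn k hf⟩, ?_, rfl⟩
      change laplace f - v n k • f = 0
      exact sub_eq_zero.2 (funext hf.2)
  have hrange : T.range = polyLT n k := by
    refine le_antisymm ?_ ?_
    · rintro _ ⟨q, rfl⟩
      exact laplace_sub_smul_mem_polyLT q.2
    · let T' := T ∘ₗ Submodule.inclusion (polyLT_mono (n := n) k.le_succ)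
      have hinj : Function.Injective T' := by
        rw [← LinearMap.ker_eq_bot, LinearMap.ker_eq_bot']
        intro q hq
        have h1 : laplace q.1 - v n k • q.1 = 0 := hq
        have h2 : q.1 ∈ eigenspace n (v n k) :=
          ⟨polyLT_le_smoothFun q.2, fun x => congrFun (sub_eq_zero.1 h1) x⟩
        exact Subtype.ext (eq_zero_of_mem_eigenspace h2 q.2 fun m hm => (v_strictMono hn hm).ne)
      have h1 : T'.range = polyLT n k := by
        refine Submodule.eq_of_le_of_finrank_eq ?_ (LinearMap.finrank_range_of_inj hinj)
        rintro _ ⟨q, rfl⟩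
        exact laplace_sub_smul_mem_polyLT (Submodule.inclusion (polyLT_mono k.le_succ) q).2
      rw [← h1]
      exact LinearMap.range_comp_le_range _ _
  rw [← LinearMap.finrank_range_add_finrank_ker T, hrange, ← hker,
    Submodule.finrank_map_subtype_eq]

theorem finrank_polyLT_eq_sum (hn : 0 < n) (k : ℕ) :
    Module.finrank ℝ (polyLT n k) =
      ∑ j ∈ Finset.range k, Module.finrank ℝ (eigenspace n (v n j)) := by
  induction k with
  | zero => simp [polyLT_zero]
  | succ k ih => rw [finrank_polyLT_succ hn, ih, Finset.sum_range_succ]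

theorem mult_v (hn : 0 < n) (k : ℕ) :
    mult n (v n k) = Module.finrank ℝ (eigenspace n (v n k)) := by
  have : FiniteDimensional ℝ (eigenspace n (v n k)) :=
    Submodule.finiteDimensional_of_le (eigenspace_v_le hn k)
  rw [mult, ← Module.finrank_eq_rank, Cardinal.toENat_nat]

theorem mult_eq_zero {μ : ℝ} (h : ∀ m, v n m ≠ μ) : mult n μ = 0 := by
  rw [mult, eigenspace_eq_bot h]
  simp

theorem counting_v (hn : 0 < n) (k : ℕ) :
    counting n (v n k) = Module.finrank ℝ (polyLT n (k + 1)) := by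
  classical
  have hinj := (v_strictMono hn).injective
  -- Of the uncountably many `μ ≤ v_k`, only `v_0, …, v_k` can carry nonzero multiplicity.
  rw [counting, tsum_subtype (Set.Iic (v n k)) (mult n),
    tsum_eq_sum (s := (Finset.range (k + 1)).image (v n)), Finset.sum_image hinj.injOn,
    finrank_polyLT_eq_sum hn, Nat.cast_sum]
  · refine Finset.sum_congr rfl fun j hj => ?_
    rw [Set.indicator_of_mem, mult_v hn]
    exact (v_strictMono hn).monotone (Nat.lt_succ_iff.1 (Finset.mem_range.1 hj))
  · intro μ hμ
    rw [Set.indicator_apply_eq_zero]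
    intro hle
    refine mult_eq_zero fun m hm => hμ ?_
    subst hm
    exact Finset.mem_image_of_mem _ (Finset.mem_range.2 (Nat.lt_succ_iff.2
      ((v_strictMono hn).le_iff_le.1 hle)))

/-! ### The dimension of the space of polynomial functions -/

/-- The polynomials in `n` variables of degree less than `k`. -/
def mvPolyLT (n k : ℕ) : Submodule ℝ (MvPolynomial (Fin n) ℝ) :=
  Submodule.span ℝ ((fun α => MvPolynomial.monomial α 1) '' {α : Fin n →₀ ℕ | α.degree < k})

theorem finite_degree_lt (n k : ℕ) : {α : Fin n →₀ ℕ | α.degree < k}.Finite :=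
  (Finsupp.finite_of_degree_le k).subset fun α (hα : α.degree < k) => hα.le

theorem ncard_degree_lt_succ (n k : ℕ) :
    {α : Fin n →₀ ℕ | α.degree < k + 1}.ncard = (n + k).choose n := by
  have hstep : ∀ k, {α : Fin n →₀ ℕ | α.degree < k + 1}.ncard =
      {α : Fin n →₀ ℕ | α.degree < k}.ncard + n.multichoose k := by
    intro k
    have h1 : {α : Fin n →₀ ℕ | α.degree < k + 1} =
        {α | α.degree < k} ∪ (Finset.univ.finsuppAntidiag k : Finset (Fin n →₀ ℕ)) := by
      ext α
      have hα : Finset.univ.sum ⇑α = α.degree := (Finsupp.degree_eq_sum α).symm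
      simp only [Set.mem_union, Set.mem_ofPred_eq, Finset.mem_coe, Finset.mem_finsuppAntidiag,
        Finset.subset_univ, and_true, hα]
      omega
    rw [h1, Set.ncard_union_eq _ (finite_degree_lt n k) (Finset.finite_toSet _),
      Set.ncard_coe_finset, Finset.card_finsuppAntidiag_nat_eq_multichoose, Finset.card_fin]
    rw [Set.disjoint_left]
    intro α h2 h3
    have hα : Finset.univ.sum ⇑α = α.degree := (Finsupp.degree_eq_sum α).symm
    simp only [Set.mem_ofPred_eq, Finset.mem_coe, Finset.mem_finsuppAntidiag, hα] at h2 h3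
    omega
  have h : {α : Fin n →₀ ℕ | α.degree < k + 1}.ncard = (n + 1).multichoose k := by
    induction k with
    | zero => rw [hstep]; simp
    | succ k ih => rw [hstep, ih, Nat.multichoose_succ_succ, add_comm]
  rw [h, Nat.multichoose_eq, Nat.choose_symm_of_eq_add (by omega : n + 1 + k - 1 = k + n)]
  congr 1
  omega

instance (n k : ℕ) : FiniteDimensional ℝ (mvPolyLT n k) :=
  FiniteDimensional.span_of_finite ℝ ((finite_degree_lt n k).image _)

theorem finrank_mvPolyLT (n k : ℕ) :
    Module.finrank ℝ (mvPolyLT n k) = {α : Fin n →₀ ℕ | α.degree < k}.ncard := by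
  have := (finite_degree_lt n k).fintype
  have h : LinearIndependent ℝ fun α : {α : Fin n →₀ ℕ | α.degree < k} =>
      MvPolynomial.monomial (α : Fin n →₀ ℕ) (1 : ℝ) :=
    (MvPolynomial.basisMonomials (Fin n) ℝ).linearIndependent.comp _ Subtype.val_injective
  have h1 := finrank_span_eq_card h
  rw [Set.ncard_eq_toFinset_card', Set.toFinset_card, ← h1, mvPolyLT, Set.image_eq_range]

theorem finrank_mvPolyLT_succ (n k : ℕ) :
    Module.finrank ℝ (mvPolyLT n (k + 1)) = (n + k).choose n := by
  rw [finrank_mvPolyLT, ncard_degree_lt_succ]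

theorem finrank_mvPolyLT_eq (hn : 0 < n) (k : ℕ) :
    Module.finrank ℝ (mvPolyLT n k) = (n + k - 1).choose n := by
  cases k with
  | zero =>
    rw [finrank_mvPolyLT, Nat.choose_eq_zero_of_lt (by omega)]
    simp
  | succ k =>
    rw [finrank_mvPolyLT_succ]
    rfl

theorem mvPolyLT_mono {k l : ℕ} (h : k ≤ l) : mvPolyLT n k ≤ mvPolyLT n l :=
  Submodule.span_mono (Set.image_mono fun _ hα => lt_of_lt_of_le hα h)

theorem X_mul_mem_mvPolyLT {k : ℕ} {p : MvPolynomial (Fin n) ℝ} (hp : p ∈ mvPolyLT n k)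
    (i : Fin n) : MvPolynomial.X i * p ∈ mvPolyLT n (k + 1) := by
  have : mvPolyLT n k ≤
      (mvPolyLT n (k + 1)).comap (LinearMap.mulLeft ℝ (MvPolynomial.X i)) := by
    rw [mvPolyLT, Submodule.span_le]
    rintro _ ⟨α, hα, rfl⟩
    refine Submodule.subset_span ⟨α + Finsupp.single i 1, ?_, ?_⟩
    · have : α.degree < k := hα
      simp only [Set.mem_ofPred_eq, map_add, Finsupp.degree_single]
      omega
    · simp [MvPolynomial.X, MvPolynomial.monomial_mul, add_comm]
  exact this hp

/-- Polynomials in all coordinates but the first as functions on the sphere. -/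
def evalTail (n : ℕ) : MvPolynomial (Fin n) ℝ →ₐ[ℝ] (Sph n → ℝ) :=
  MvPolynomial.aeval fun i => coord i.succ

theorem evalTail_apply (p : MvPolynomial (Fin n) ℝ) (x : Sph n) :
    evalTail n p x = MvPolynomial.eval (fun i => (x : Amb n) i.succ) p := by
  have h : (Pi.evalAlgHom ℝ (fun _ : Sph n => ℝ) x).comp (evalTail n) =
      MvPolynomial.aeval fun i => (x : Amb n) i.succ := by
    ext i
    simp [evalTail, coord]
  exact DFunLike.congr_fun h p

theorem evalTail_mem_polyLT {k : ℕ} {p : MvPolynomial (Fin n) ℝ} (hp : p ∈ mvPolyLT n k) :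
    evalTail n p ∈ polyLT n k := by
  have : mvPolyLT n k ≤ (polyLT n k).comap (evalTail n).toLinearMap := by
    rw [mvPolyLT, Submodule.span_le]
    rintro _ ⟨α, hα, rfl⟩
    refine polyLT_mono (Nat.succ_le_of_lt hα) ?_
    change evalTail n (MvPolynomial.monomial α 1) ∈ polyLT n (α.degree + 1)
    clear hα
    induction α using finsupp_induction_add_single with
    | zero =>
      rw [MvPolynomial.monomial_zero', map_one, map_one, ← mono_zero]
      exact mono_mem_polyLT (by simp)
    | add α i ih =>
      have h : MvPolynomial.monomial (α + Finsupp.single i 1) (1 : ℝ) =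
          MvPolynomial.X i * MvPolynomial.monomial α 1 := by
        simp [MvPolynomial.X, MvPolynomial.monomial_mul, add_comm]
      have h' : evalTail n (MvPolynomial.X i) = coord i.succ := by simp [evalTail]
      rw [h, map_mul, h', map_add, Finsupp.degree_single]
      exact coord_mul_mem_polyLT ih _
  exact this hp

/-- Pairs `(a, b)` of polynomials in all coordinates but the first as the function `a + x₀ b` on
the sphere. -/
def evalPair (n k : ℕ) : (mvPolyLT n (k + 1) × mvPolyLT n k) →ₗ[ℝ] (Sph n → ℝ) :=
  LinearMap.coprod ((evalTail n).toLinearMap ∘ₗ (mvPolyLT n (k + 1)).subtype)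
    (LinearMap.mulLeft ℝ (coord 0) ∘ₗ (evalTail n).toLinearMap ∘ₗ (mvPolyLT n k).subtype)

theorem evalPair_apply (k : ℕ) (p : mvPolyLT n (k + 1) × mvPolyLT n k) :
    evalPair n k p = evalTail n p.1 + coord 0 * evalTail n p.2 := rfl

theorem mem_range_evalPair {k : ℕ} {a b : MvPolynomial (Fin n) ℝ} (ha : a ∈ mvPolyLT n (k + 1))
    (hb : b ∈ mvPolyLT n k) : evalTail n a + coord 0 * evalTail n b ∈ (evalPair n k).range :=
  ⟨(⟨a, ha⟩, ⟨b, hb⟩), rfl⟩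

theorem coord_mul_mem_range_evalPair {k : ℕ} {f : Sph n → ℝ} (hf : f ∈ (evalPair n k).range)
    (i : Fin (n + 1)) : coord i * f ∈ (evalPair n (k + 1)).range := by
  obtain ⟨⟨⟨a, ha⟩, ⟨b, hb⟩⟩, rfl⟩ := hf
  rw [evalPair_apply]
  refine Fin.cases ?_ (fun i => ?_) i
  -- Multiplying `a + x₀ b` by `x₀` and replacing `x₀²` by `1 - ∑ xᵢ²` gives the new pair `((1 - ∑
  -- xᵢ²) b, a)`.
  · have h1 : (b - ∑ i, MvPolynomial.X i * (MvPolynomial.X i * b) :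
        MvPolynomial (Fin n) ℝ) ∈ mvPolyLT n (k + 1 + 1) :=
      sub_mem (mvPolyLT_mono (by omega) hb)
        (sum_mem fun i _ => X_mul_mem_mvPolyLT (X_mul_mem_mvPolyLT hb i) i)
    convert! mem_range_evalPair h1 ha using 1
    ext x
    have h3 := sum_coord_sq x
    rw [Fin.sum_univ_succ] at h3
    have h4 : ∀ i : Fin n, evalTail n (MvPolynomial.X i) = coord i.succ := fun i => by
      simp [evalTail]
    simp only [map_sub, map_sum, map_mul, map_pow, Pi.pow_apply, h4, Pi.add_apply, Pi.sub_apply,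
      Pi.mul_apply, Finset.sum_apply, ← mul_assoc, ← Finset.sum_mul, ← pow_two]
    linear_combination evalTail n b x * h3
  · convert! mem_range_evalPair (X_mul_mem_mvPolyLT ha i) (X_mul_mem_mvPolyLT hb i) using 1
    have h4 : evalTail n (MvPolynomial.X i) = coord i.succ := by simp [evalTail]
    simp only [map_mul, h4]
    ring

theorem range_evalPair_mono {k l : ℕ} (h : k ≤ l) :
    (evalPair n k).range ≤ (evalPair n l).range := by
  rintro _ ⟨⟨⟨a, ha⟩, ⟨b, hb⟩⟩, rfl⟩
  exact mem_range_evalPair (mvPolyLT_mono (by omega) ha) (mvPolyLT_mono h hb)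

theorem range_evalPair (k : ℕ) : (evalPair n k).range = polyLT n (k + 1) := by
  refine le_antisymm ?_ ?_
  · rintro _ ⟨⟨⟨a, ha⟩, ⟨b, hb⟩⟩, rfl⟩
    exact add_mem (evalTail_mem_polyLT ha) (coord_mul_mem_polyLT (evalTail_mem_polyLT hb) 0)
  · rw [polyLT, Submodule.span_le]
    rintro _ ⟨α, hα, rfl⟩
    refine range_evalPair_mono (Nat.lt_succ_iff.1 hα) ?_
    clear hα
    induction α using finsupp_induction_add_single with
    | zero =>
      have h1 : (1 : MvPolynomial (Fin n) ℝ) ∈ mvPolyLT n 1 :=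
        Submodule.subset_span ⟨0, by simp, by simp⟩
      have h2 := mem_range_evalPair h1 (zero_mem _)
      rw [map_one, map_zero, mul_zero, add_zero] at h2
      rwa [map_zero, mono_zero]
    | add α i ih =>
      rw [mono_add_single, map_add, Finsupp.degree_single]
      exact coord_mul_mem_range_evalPair ih i

/-- Over each `y` in the open unit ball lie two points `(±t, y)` of the sphere with `t > 0`.
Vanishing at both forces `a(y) = b(y) = 0`, and a polynomial that vanishes on a box with infinite
sides is zero. -/
theorem evalPair_injective (k : ℕ) : Function.Injective (evalPair n k) := by
  rw [← LinearMap.ker_eq_bot, LinearMap.ker_eq_bot']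
  rintro ⟨⟨a, ha⟩, ⟨b, hb⟩⟩ h
  rw [evalPair_apply] at h
  -- The side `1/(n+1)` ensures `∑ yᵢ² ≤ n/(n+1) < 1`.
  have key : ∀ y ∈ Set.pi Set.univ fun _ : Fin n => Set.Ioo (0 : ℝ) (1 / (n + 1)),
      MvPolynomial.eval y a = 0 ∧ MvPolynomial.eval y b = 0 := by
    intro y hy
    have hn : (0 : ℝ) < n + 1 := by positivity
    have hsum : ∑ i, y i ^ 2 < 1 := by
      calc ∑ i, y i ^ 2 ≤ ∑ _i : Fin n, (1 / ((n : ℝ) + 1)) := by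
            refine Finset.sum_le_sum fun i _ => ?_
            have h1 := hy i trivial
            have h2 : 1 / ((n : ℝ) + 1) ≤ 1 := by
              rw [div_le_one hn]
              linarith [(Nat.cast_nonneg n : (0 : ℝ) ≤ n)]
            nlinarith [h1.1, h1.2]
        _ = n / (n + 1) := by
            simp
            ring
        _ < 1 := by
            rw [div_lt_one hn]
            linarith
    set t := √(1 - ∑ i, y i ^ 2) with ht
    have ht0 : 0 < t := Real.sqrt_pos.2 (by linarith)
    have ht2 : t ^ 2 = 1 - ∑ i, y i ^ 2 := Real.sq_sqrt (by linarith)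
    have hpt : ∀ s : ℝ, s ^ 2 = t ^ 2 → MvPolynomial.eval y a + s * MvPolynomial.eval y b = 0 := by
      intro s hs
      let z : Sph n := ⟨WithLp.toLp 2 (Fin.cons s y), by
        rw [mem_sphere_zero_iff_norm, EuclideanSpace.norm_eq, Real.sqrt_eq_one, Fin.sum_univ_succ]
        simp [hs, ht2]⟩
      have hz := congrFun h z
      simpa [evalTail_apply, z, coord] using hz
    have h1 := hpt t rfl
    have h2 := hpt (-t) (by ring)
    constructor
    · linarith
    · have : t * MvPolynomial.eval y b = 0 := by linarith
      exact (mul_eq_zero.1 this).resolve_left ht0.ne'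
  have hinf : ∀ _i : Fin n, (Set.Ioo (0 : ℝ) (1 / (n + 1))).Infinite := fun _ =>
    Set.Ioo_infinite (by positivity)
  have ha0 : a = 0 := MvPolynomial.funext_set _ hinf fun y hy => by simpa using (key y hy).1
  have hb0 : b = 0 := MvPolynomial.funext_set _ hinf fun y hy => by simpa using (key y hy).2
  simp [ha0, hb0]

theorem finrank_polyLT (hn : 0 < n) (k : ℕ) :
    Module.finrank ℝ (polyLT n (k + 1)) = (n + k).choose n + (n + k - 1).choose n := by
  rw [← range_evalPair, LinearMap.finrank_range_of_inj (evalPair_injective k),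
    Module.finrank_prod, finrank_mvPolyLT_succ, finrank_mvPolyLT_eq hn]

/-! ### Closed form of the Weyl function -/

theorem ballVolume_eq (hn : 0 < n) : ballVolume n = √Real.pi ^ n / Real.Gamma (n / 2 + 1) := by
  have : Nonempty (Fin n) := ⟨⟨0, hn⟩⟩
  rw [ballVolume, EuclideanSpace.volume_ball]
  simp only [ENNReal.ofReal_one, one_pow, one_mul, Fintype.card_fin]
  exact ENNReal.toReal_ofReal
    (div_nonneg (by positivity) (Real.Gamma_pos_of_pos (by positivity)).le)

theorem sphereVolume_eq (n : ℕ) : sphereVolume n = (n + 1) * ballVolume (n + 1) := by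
  rw [sphereVolume, MeasureTheory.Measure.toSphere_apply_univ, ENNReal.toReal_mul, ballVolume,
    finrank_euclideanSpace_fin, ENNReal.toReal_natCast, Nat.cast_succ]

/-- Legendre duplication at `n/2 + 1` evaluates the product of the two Gamma factors as `(n+1)! √π /
2^{n+1}`, and all powers of `π` cancel. -/
theorem weyl_eq (hn : 0 < n) (x : ℝ) : weyl n x = 2 / n.factorial * x ^ ((n : ℝ) / 2) := by
  have hG := Real.Gamma_mul_Gamma_add_half ((n : ℝ) / 2 + 1)
  have h1 : 2 * ((n : ℝ) / 2 + 1) = ((n + 1 : ℕ) : ℝ) + 1 := by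
    push_cast
    ring
  have h2 : (n : ℝ) / 2 + 1 + 1 / 2 = ((n + 1 : ℕ) : ℝ) / 2 + 1 := by
    push_cast
    ring
  have h3 : (2 : ℝ) ^ (1 - (((n + 1 : ℕ) : ℝ) + 1)) = ((2 : ℝ) ^ (n + 1))⁻¹ := by
    rw [← Real.rpow_natCast, ← Real.rpow_neg (by norm_num)]
    congr 1
    ring
  rw [h1, h2, h3, Real.Gamma_nat_eq_factorial] at hG
  have hpos1 : 0 < Real.Gamma ((n : ℝ) / 2 + 1) := Real.Gamma_pos_of_pos (by positivity)
  have hpos2 : 0 < Real.Gamma (((n + 1 : ℕ) : ℝ) / 2 + 1) := Real.Gamma_pos_of_pos (by positivity)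
  have hsqrt : √Real.pi * √Real.pi = Real.pi := Real.mul_self_sqrt Real.pi_pos.le
  have hs0 : 0 < √Real.pi := Real.sqrt_pos.2 Real.pi_pos
  have hpi : Real.pi ^ n = √Real.pi ^ n * √Real.pi ^ n := by rw [← mul_pow, hsqrt]
  rw [weyl, sphereVolume_eq, ballVolume_eq hn, ballVolume_eq n.succ_pos]
  congr 1
  have h4 : √Real.pi ^ n / Real.Gamma (n / 2 + 1) / (2 * Real.pi) ^ n *
      ((n + 1) * (√Real.pi ^ (n + 1) / Real.Gamma (((n + 1 : ℕ) : ℝ) / 2 + 1))) =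
      (n + 1) * √Real.pi / (2 ^ n * (Real.Gamma (n / 2 + 1) *
        Real.Gamma (((n + 1 : ℕ) : ℝ) / 2 + 1))) := by
    rw [mul_pow, hpi, pow_succ]
    field_simp
  rw [h4, hG, Nat.factorial_succ]
  push_cast
  field_simp
  ring

/-! ### The two inequalities -/

/-- The two binomials share the factor `(k+1)⋯(k+m)`, with cofactors `k + m + 1` and `k`. -/
theorem factorial_mul_choose_add_choose (m k : ℕ) :
    ((m + 1).factorial : ℝ) *
      (((m + 1 + k).choose (m + 1) + (m + 1 + k - 1).choose (m + 1) : ℕ) : ℝ) =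
    (2 * k + m + 1) * ∏ i ∈ Finset.range m, ((k : ℝ) + 1 + i) := by
  have h1 : (m + 1).factorial * (m + 1 + k).choose (m + 1) =
      (k + 1 + m) * (k + 1).ascFactorial m := by
    rw [← Nat.ascFactorial_succ, Nat.ascFactorial_eq_factorial_mul_choose, add_comm k]
  have h2 : (m + 1).factorial * (m + 1 + k - 1).choose (m + 1) = k * (k + 1).ascFactorial m := by
    rw [Nat.ascFactorial_eq_factorial_mul_choose, Nat.factorial_succ]
    have h3 := Nat.choose_succ_right_eq (k + m) m
    have h4 : m + 1 + k - 1 = k + m := by omega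
    rw [Nat.add_sub_cancel] at h3
    rw [h4]
    calc (m + 1) * m.factorial * (k + m).choose (m + 1)
        = m.factorial * ((k + m).choose (m + 1) * (m + 1)) := by ring
      _ = _ := by rw [h3]; ring
  have h5 : ((k + 1).ascFactorial m : ℝ) = ∏ i ∈ Finset.range m, ((k : ℝ) + 1 + i) := by
    rw [Nat.ascFactorial_eq_prod_range]
    push_cast
    rfl
  have h6 : (m + 1).factorial *
      ((m + 1 + k).choose (m + 1) + (m + 1 + k - 1).choose (m + 1)) =
      (2 * k + m + 1) * (k + 1).ascFactorial m := by
    rw [mul_add, h1, h2]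
    ring
  rw [← h5]
  exact_mod_cast h6

theorem rpow_half_sq {x : ℝ} (hx : 0 ≤ x) (n : ℕ) : (x ^ ((n : ℝ) / 2)) ^ 2 = x ^ n := by
  rw [← Real.rpow_natCast, ← Real.rpow_mul hx, ← Real.rpow_natCast x]
  congr 1
  push_cast
  ring

/-- One of the two copies of the product is reversed, so that factors with constant sum `2k + m + 1`
are paired. -/
theorem sq_half_mul_prod (m k : ℕ) :
    ((k + ((m : ℝ) + 1) / 2) * ∏ i ∈ Finset.range m, ((k : ℝ) + 1 + i)) ^ 2 =
      (k + ((m : ℝ) + 1) / 2) ^ 2 *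
        ∏ i ∈ Finset.range m, (((k : ℝ) + 1 + i) * (k + m - i)) := by
  rw [mul_pow, Finset.prod_mul_distrib, pow_two (∏ i ∈ Finset.range m, _)]
  congr 2
  rw [← Finset.prod_range_reflect]
  refine Finset.prod_congr rfl fun i hi => ?_
  have hi' := Finset.mem_range.1 hi
  have h : ((m - 1 - i : ℕ) : ℝ) = m - 1 - i := by
    rw [Nat.sub_sub, Nat.cast_sub (by omega)]
    push_cast
    ring
  rw [h]
  ring

theorem rpow_v_lt (m k : ℕ) :
    v (m + 1) k ^ (((m + 1 : ℕ) : ℝ) / 2) <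
      (k + ((m : ℝ) + 1) / 2) * ∏ i ∈ Finset.range m, ((k : ℝ) + 1 + i) := by
  have hk : (0 : ℝ) ≤ k := Nat.cast_nonneg k
  have hm : (0 : ℝ) ≤ m := Nat.cast_nonneg m
  have hv : v (m + 1) k = k * (k + m) := by
    simp only [v]
    push_cast
    ring
  have hv0 : 0 ≤ v (m + 1) k := by
    rw [hv]
    positivity
  refine lt_of_pow_lt_pow_left₀ 2 (by positivity) ?_
  rw [rpow_half_sq hv0, sq_half_mul_prod, pow_succ']
  -- The difference of the two sides is `k + (1 + i)(m - i)`.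
  have hfac : ∀ i ∈ Finset.range m, v (m + 1) k < ((k : ℝ) + 1 + i) * (k + m - i) := by
    intro i hi
    have h1 : (i : ℝ) + 1 ≤ m := by exact_mod_cast Finset.mem_range.1 hi
    have h2 : (0 : ℝ) ≤ i := Nat.cast_nonneg i
    rw [hv]
    nlinarith [mul_pos (by linarith : (0 : ℝ) < 1 + i) (by linarith : (0 : ℝ) < m - i)]
  have hprod : v (m + 1) k ^ m ≤ ∏ i ∈ Finset.range m, (((k : ℝ) + 1 + i) * (k + m - i)) := by
    rw [← Finset.card_range m, ← Finset.prod_const, Finset.card_range]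
    exact Finset.prod_le_prod (fun _ _ => hv0) fun i hi => (hfac i hi).le
  have hpos : 0 < ∏ i ∈ Finset.range m, (((k : ℝ) + 1 + i) * (k + m - i)) :=
    Finset.prod_pos fun i hi => hv0.trans_lt (hfac i hi)
  calc v (m + 1) k * v (m + 1) k ^ m
      ≤ v (m + 1) k * ∏ i ∈ Finset.range m, (((k : ℝ) + 1 + i) * (k + m - i)) := by gcongr
    _ < _ := by
      refine mul_lt_mul_of_pos_right ?_ hpos
      rw [hv]
      nlinarith

theorem lt_rpow_v_succ (m k : ℕ) (h : ((m : ℝ) + 1) ^ 2 / 4 - (m + 1) < k) :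
    (k + ((m : ℝ) + 1) / 2) * ∏ i ∈ Finset.range m, ((k : ℝ) + 1 + i) <
      v (m + 1) (k + 1) ^ (((m + 1 : ℕ) : ℝ) / 2) := by
  have hk : (0 : ℝ) ≤ k := Nat.cast_nonneg k
  have hm : (0 : ℝ) ≤ m := Nat.cast_nonneg m
  have hv : v (m + 1) (k + 1) = (k + 1) * (k + 1 + m) := by
    simp only [v]
    push_cast
    ring
  have hv0 : 0 ≤ v (m + 1) (k + 1) := by
    rw [hv]
    positivity
  refine lt_of_pow_lt_pow_left₀ 2 (by positivity) ?_
  rw [rpow_half_sq hv0, sq_half_mul_prod, pow_succ' (v _ _)]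
  have hpos : ∀ i ∈ Finset.range m, 0 < ((k : ℝ) + 1 + i) * (k + m - i) := by
    intro i hi
    have h1 : (i : ℝ) + 1 ≤ m := by exact_mod_cast Finset.mem_range.1 hi
    exact mul_pos (by positivity) (by linarith)
  have hprod : ∏ i ∈ Finset.range m, (((k : ℝ) + 1 + i) * (k + m - i)) ≤
      v (m + 1) (k + 1) ^ m := by
    rw [← Finset.card_range m, ← Finset.prod_const, Finset.card_range]
    refine Finset.prod_le_prod (fun i hi => (hpos i hi).le) fun i hi => ?_
    rw [hv]
    -- By AM–GM `(1 + i)(m - i) ≤ (m + 1)²/4`, and by hypothesis this is less than `k + m + 1`.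
    nlinarith [sq_nonneg ((m : ℝ) - 1 - 2 * i)]
  calc (k + ((m : ℝ) + 1) / 2) ^ 2 * ∏ i ∈ Finset.range m, (((k : ℝ) + 1 + i) * (k + m - i))
      < v (m + 1) (k + 1) * ∏ i ∈ Finset.range m, (((k : ℝ) + 1 + i) * (k + m - i)) := by
        refine mul_lt_mul_of_pos_right ?_ (Finset.prod_pos hpos)
        rw [hv]
        -- The gap is exactly `k + (m + 1) - (m + 1)²/4`, positive by hypothesis; the strictness of
        -- the bound comes from this factor.
        nlinarith
    _ ≤ _ := by gcongr

theorem toNat_counting_v (m k : ℕ) :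
    ((counting (m + 1) (v (m + 1) k)).toNat : ℝ) = 2 / (m + 1).factorial *
      ((k + ((m : ℝ) + 1) / 2) * ∏ i ∈ Finset.range m, ((k : ℝ) + 1 + i)) := by
  rw [counting_v m.succ_pos, ENat.toNat_natCast, finrank_polyLT m.succ_pos]
  have h := factorial_mul_choose_add_choose m k
  have h0 : ((m + 1).factorial : ℝ) ≠ 0 := by exact_mod_cast (m + 1).factorial_ne_zero
  rw [div_mul_eq_mul_div, eq_div_iff h0, mul_comm, h]
  ring

end RoundSphere

end

theorem mainTheorem2 (n : ℕ) (hn : 0 < n) :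
    (∀ k : ℕ, RoundSphere.counting n (RoundSphere.v n k) ≠ ⊤ ∧
      RoundSphere.weyl n (RoundSphere.v n k) <
        ((RoundSphere.counting n (RoundSphere.v n k)).toNat : ℝ)) ∧
    (∀ k : ℕ, (n : ℝ) ^ 2 / 4 - (n : ℝ) < (k : ℝ) →
      ((RoundSphere.counting n (RoundSphere.v n k)).toNat : ℝ) <
        RoundSphere.weyl n (RoundSphere.v n (k + 1))) := by
  -- With `n = m + 1`, the `n - 1` middle factors are indexed by `Finset.range m`.
  obtain ⟨m, rfl⟩ : ∃ m, n = m + 1 := ⟨n - 1, by omega⟩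
  have hpos : (0 : ℝ) < 2 / (m + 1).factorial := by positivity
  refine ⟨fun k => ⟨?_, ?_⟩, fun k hk => ?_⟩
  · rw [RoundSphere.counting_v hn]
    exact ENat.natCast_ne_top _
  · rw [RoundSphere.weyl_eq hn, RoundSphere.toNat_counting_v]
    exact mul_lt_mul_of_pos_left (RoundSphere.rpow_v_lt m k) hpos
  · rw [RoundSphere.weyl_eq hn, RoundSphere.toNat_counting_v]
    refine mul_lt_mul_of_pos_left (RoundSphere.lt_rpow_v_succ m k ?_) hpos
    exact_mod_cast hk
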